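/- Let $m,n\ge 1$ be integers, $N=m+n$, $\alpha\ge 0$, $p>1$. Write points of $\mathbb{R}^N=\mathbb{R}^m\times\mathbb{R}^n$ as $z=(x,y)$ and put $Q=m+n(\alpha+1)$, $$\Delta_\alpha=\Delta_x+(\alpha+1)^2|x|^{2\alpha}\Delta_y,\qquad \nabla_\alpha=\big(\nabla_x,(\alpha+1)|x|^{\alpha}\nabla_y\big),\qquad \delta_r(x,y)=(rx,r^{\alpha+1}y),$$ $$Z=\sum_{i=1}^m x_i\partial_{x_i}+(\alpha+1)\sum_{j=1}^n y_j\partial_{y_j},\qquad \rho(x,y)=\big(|x|^{2(\alpha+1)}+|y|^2\big)^{\frac1{2(\alpha+1)}},$$ $B_r=\{\rho<r\}$, $\partial B_r=\{\rho=r\}$. Let $\sigma$ be the surface measure (the normalized $(N-1)$-dimensional Hausdorff measure) on $\partial B_1$, and let $\nabla\rho$ be the Euclidean gradient of $\rho$. **Theorem (Monotonicity formula).** Let $u\in C^2(\mathbb{R}^N)$ be a solution of $-\Delta_\alpha u=|u|^{p-1}u$ on $\mathbb{R}^N$. For $r>0$ let $u_r(z)=r^{\frac{2}{p-1}}u(\delta_r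 z)$, $$E(r,u)=r^{\frac{2(p+1)}{p-1}-Q}\Big(\frac12\int_{B_r}|\nabla_\alpha u|^2\,dz-\frac1{p+1}\int_{B_r}|u|^{p+1}\,dz\Big),$$ $$I(r,u)=E(r,u)+\int_{\partial B_1}\frac{|x|^{2\alpha}u_r^2}{(p-1)|\nabla\rho|}\,d\sigma.$$ Then all the integrals above and below converge absolutely, $r\mapsto I(r,u)$ is differentiable on $(0,\infty)$, and for every $r>0$ $$\frac{dI(r,u)}{dr}=\int_{\partial B_1}\frac{|x|^{2\alpha}}{r|\nabla\rho|}\Big(\frac{2}{p-1}u_r+Zu_r\Big)^2d\sigma\ \ge 0.$$ In particular $r\mapsto I(r,u)$ is nondecreasing on $(0,\infty)$. -/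

import Mathlib

open MeasureTheory

noncomputable section

namespace Grushin

/-- `ℝ^N = ℝ^m × ℝ^n` with its Euclidean norm and Lebesgue measure; a point `z = (x, y)` has
coordinates `x_i = z (Sum.inl i)` and `y_j = z (Sum.inr j)`. -/
abbrev Space (m n : ℕ) : Type := EuclideanSpace ℝ (Fin m ⊕ Fin n)

variable {m n : ℕ}

/-- The component `x ∈ ℝ^m` of `z = (x, y)`. -/
def xPart (z : Space m n) : EuclideanSpace ℝ (Fin m) := WithLp.toLp 2 fun i => z (Sum.inl i)

/-- The component `y ∈ ℝ^n` of `z = (x, y)`. -/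
def yPart (z : Space m n) : EuclideanSpace ℝ (Fin n) := WithLp.toLp 2 fun j => z (Sum.inr j)

/-- The partial derivative of `u` in the `k`-th coordinate direction. -/
def partialDeriv (k : Fin m ⊕ Fin n) (u : Space m n → ℝ) (z : Space m n) : ℝ :=
  fderiv ℝ u z (EuclideanSpace.single k 1)

/-- The Baouendi-Grushin operator `Δ_α = Δ_x + (α + 1)² |x|^{2α} Δ_y`. -/
def grushinLaplacian (α : ℝ) (u : Space m n → ℝ) (z : Space m n) : ℝ :=
  ∑ i : Fin m, partialDeriv (Sum.inl i) (partialDeriv (Sum.inl i) u) z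
    + (α + 1) ^ 2 * ‖xPart z‖ ^ (2 * α)
      * ∑ j : Fin n, partialDeriv (Sum.inr j) (partialDeriv (Sum.inr j) u) z

/-- The Grushin gradient `∇_α u = (∇_x u, (α + 1) |x|^α ∇_y u)`. -/
def grushinGradient (α : ℝ) (u : Space m n → ℝ) (z : Space m n) : Space m n :=
  WithLp.toLp 2 (Sum.elim
    (fun i => partialDeriv (Sum.inl i) u z)
    (fun j => (α + 1) * ‖xPart z‖ ^ α * partialDeriv (Sum.inr j) u z))

/-- The non-isotropic dilation `δ_r (x, y) = (r x, r^{α+1} y)`. -/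
def dilation (α r : ℝ) (z : Space m n) : Space m n :=
  WithLp.toLp 2 (Sum.elim (fun i => r * z (Sum.inl i)) (fun j => r ^ (α + 1) * z (Sum.inr j)))

/-- The infinitesimal generator of the dilations,
`Z u = ∑ x_i ∂_{x_i} u + (α + 1) ∑ y_j ∂_{y_j} u`. -/
def generator (α : ℝ) (u : Space m n → ℝ) (z : Space m n) : ℝ :=
  ∑ i : Fin m, z (Sum.inl i) * partialDeriv (Sum.inl i) u z
    + ∑ j : Fin n, (α + 1) * z (Sum.inr j) * partialDeriv (Sum.inr j) u z

/-- The homogeneous dimension `Q = m + n (α + 1)`. -/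
def homDim (m n : ℕ) (α : ℝ) : ℝ := m + n * (α + 1)

/-- The gauge `ρ(x, y) = (|x|^{2(α+1)} + |y|²)^{1/(2(α+1))}`. -/
def gauge (α : ℝ) (z : Space m n) : ℝ :=
  (‖xPart z‖ ^ (2 * (α + 1)) + ‖yPart z‖ ^ 2) ^ (1 / (2 * (α + 1)))

/-- The gauge ball `B_r = {ρ < r}` in `ℝ^m × ℝ^n`. -/
def gaugeBall (m n : ℕ) (α r : ℝ) : Set (Space m n) := {z | gauge α z < r}

/-- The gauge sphere `∂B_r = {ρ = r}` in `ℝ^m × ℝ^n`. -/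
def gaugeSphere (m n : ℕ) (α r : ℝ) : Set (Space m n) := {z | gauge α z = r}

/-- The surface measure `dσ` on `∂B_1`: the restriction to `∂B_1` of the `(N-1)`-dimensional
Euclidean Hausdorff measure, normalized so that it agrees with Lebesgue measure on `ℝ^{N-1}`. -/
def surfaceMeasure (m n : ℕ) (α : ℝ) : Measure (Space m n) :=
  (Measure.euclideanHausdorffMeasure (m + n - 1)).restrict (gaugeSphere m n α 1)

/-- `u` is a `C²` solution of `-Δ_α u = |u|^{p-1} u` on `ℝ^N`. -/
def IsC2Solution (α p : ℝ) (u : Space m n → ℝ) : Prop :=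
  ContDiff ℝ 2 u ∧ ∀ z, -grushinLaplacian α u z = |u z| ^ (p - 1) * u z

/-- The rescaled function `u_r(z) = r^{2/(p-1)} u(δ_r z)`. -/
def rescale (α p r : ℝ) (u : Space m n → ℝ) (z : Space m n) : ℝ :=
  r ^ (2 / (p - 1)) * u (dilation α r z)

/-- The scaled energy `E(r, u)`. -/
def energy (α p r : ℝ) (u : Space m n → ℝ) : ℝ :=
  r ^ (2 * (p + 1) / (p - 1) - homDim m n α)
    * (1 / 2 * (∫ z in gaugeBall m n α r, ‖grushinGradient α u z‖ ^ 2)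
      - 1 / (p + 1) * ∫ z in gaugeBall m n α r, |u z| ^ (p + 1))

/-- The integrand `|x|^{2α} u_r² / ((p - 1) |∇ρ|)` of the boundary term of `I(r, u)`;
`∇ρ` is the ordinary Euclidean gradient. -/
def boundaryDensity (α p r : ℝ) (u : Space m n → ℝ) (z : Space m n) : ℝ :=
  ‖xPart z‖ ^ (2 * α) * rescale α p r u z ^ 2 / ((p - 1) * ‖gradient (gauge α) z‖)

/-- The functional `I(r, u) = E(r, u) + ∫_{∂B_1} |x|^{2α} u_r² / ((p - 1) |∇ρ|) dσ`. -/
def monotoneEnergy (α p r : ℝ) (u : Space m n → ℝ) : ℝ :=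
  energy α p r u + ∫ z, boundaryDensity α p r u z ∂(surfaceMeasure m n α)

/-- The integrand `|x|^{2α} / (r |∇ρ|) * (2 u_r / (p - 1) + Z u_r)²` of `dI/dr`. -/
def dissipationDensity (α p r : ℝ) (u : Space m n → ℝ) (z : Space m n) : ℝ :=
  ‖xPart z‖ ^ (2 * α) / (r * ‖gradient (gauge α) z‖)
    * (2 / (p - 1) * rescale α p r u z + generator α (rescale α p r u) z) ^ 2

end Grushin

end

/-!
Write `a = 2 / (p - 1)`, `w = a u + Zu` and let `A = diag (1, (α + 1)² |x|^{2α})` be the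
coefficient matrix of `Δ_α`. By homogeneity the scaled energy `E(r, u)` is the unscaled energy of
`u_r` on the fixed ball `B_1`, and `∂_r u_r = r^{a-1} w ∘ δ_r`. Differentiating under the integral
sign, `dE/dr` is a power of `r` times the integral over `B_r` of `⟨A∇u, ∇w⟩ - |u|^{p-1} u w`
(`hasDerivAt_energy`). The equation turns this into `⟨A∇u, ∇w⟩ + w Δ_α u`, to which Green's
formula applies. The point is that `A∇ρ = ρ^{-(2α+1)} |x|^{2α} Z`
(`coeff_mul_partialDeriv_gauge`), so that the conormal derivative of `u` on a gauge sphere is a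
multiple of `Zu`, and `dE/dr` is `r^{2a-1} ∫ |x|^{2α} w Zu` over the sphere. The boundary term of
`I` contributes `r^{2a-1} ∫ |x|^{2α} w (a u)`, and the two add up to the square `w²`.

All surface integrals are handled through the cone measure `τ`, the image of Lebesgue measure on
`B_1` under the radial projection `z ↦ δ_{1/ρ(z)} z`, times `Q`. In the coordinates `(ρ, δ_{1/ρ}
z)` Lebesgue measure is exactly `s^{Q-1} ds ⊗ τ` (`map_polar_volume`). The link with the Hausdorff
measure is `σ = |∇ρ| τ` (`surfaceMeasure_eq_withDensity`), proved by comparing both measures near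
each point `ω` of the sphere. The map `flattening` sends the sector over a subset `A` of the
sphere to a cylinder whose base is the projection of `A` to the tangent plane; its Jacobian at `ω`
is `|∇ρ(ω)|`, and near `ω` the projection distorts Hausdorff measure by a factor close to `1`. So
`σ` and `|∇ρ| τ` agree locally up to factors arbitrarily close to `1`, and a countable cover
concludes.

Green's formula (`green_gaugeBall`) needs no divergence theorem on a domain: the `y`-components of
`A∇u` need not be differentiable in `x`, but the `k`-th component of `A∇u` is `C¹` in the `k`-th
direction, so one can integrate by parts on the whole space, one direction at a time, against
cutoffs `φ(ρ)`. In polar coordinates the result is an identity of distributions in the radius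
between continuous functions, hence a pointwise one.
-/

noncomputable section

/-! ### Hausdorff measure and orthogonal projections to a hyperplane -/

namespace HyperplaneProjection

open Measure Module Filter
open scoped NNReal ENNReal Topology RealInnerProductSpace

variable {E : Type*} [NormedAddCommGroup E] [InnerProductSpace ℝ E]

/-- The orthogonal projection to the hyperplane `ν^⊥`. -/
abbrev perp (ν : E) : E →L[ℝ] E := (ℝ ∙ ν)ᗮ.starProjection

lemma perp_apply {ν : E} (hν : ‖ν‖ = 1) (v : E) : perp ν v = v - ⟪ν, v⟫ • ν := by
  rw [perp, Submodule.starProjection_orthogonal_val, Submodule.starProjection_unit_singleton ℝ hν]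

lemma norm_perp_le (ν v : E) : ‖perp ν v‖ ≤ ‖v‖ :=
  (ℝ ∙ ν)ᗮ.norm_starProjection_apply_le v

variable [FiniteDimensional ℝ E] [MeasurableSpace E] [BorelSpace E]

/-- The volume of a right cylinder is the measure of its base times its height. -/
lemma volume_cylinder {ν : E} (hν : ‖ν‖ = 1) (A : Set E) (I : Set ℝ) :
    volume {z | ∃ a ∈ A, ∃ t ∈ I, z = perp ν a + t • ν}
      = volume I * μHE[finrank ℝ E - 1] (perp ν '' A) := by
  set s : Submodule ℝ E := ℝ ∙ ν
  have hν0 : ν ≠ 0 := by rintro rfl; simp at hν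
  have hrank : finrank ℝ sᗮ = finrank ℝ E - 1 := by
    rw [← s.finrank_add_finrank_orthogonal, finrank_span_singleton hν0, Nat.add_sub_cancel_left]
  let e : ℝ ≃ₗᵢ[ℝ] s := LinearIsometryEquiv.toSpanUnitSingleton ν hν
  have h1 : volume (e '' I) = volume I := by
    have := e.measurePreserving.measure_preimage_emb
      e.toHomeomorph.measurableEmbedding (e '' I)
    rwa [Set.preimage_image_eq _ e.injective, eq_comm] at this
  have h2 : volume (sᗮ.orthogonalProjectionOnto '' A) = μHE[finrank ℝ E - 1] (perp ν '' A) := by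
    rw [← InnerProductSpace.euclideanHausdorffMeasure_eq_volume, hrank,
      ← (isometry_subtype_coe (s := (sᗮ : Set E))).euclideanHausdorffMeasure_image, Set.image_image]
    rfl
  have hmp := s.measurePreserving_measurableEquivProd (0 : E)
  rw [InnerProductSpace.euclideanHausdorffMeasure_eq_volume] at hmp
  rw [← h1, ← h2, ← Measure.prod_prod, ← Measure.volume_eq_prod, ← hmp.measure_preimage_equiv]
  congr 1
  ext z
  simp only [Set.mem_ofPred_eq, Set.mem_preimage, Submodule.measurableEquivProd_apply, Set.mem_prod,
    vsub_eq_sub, sub_zero, Set.mem_image]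
  constructor
  · rintro ⟨a, ha, t, ht, rfl⟩
    refine ⟨⟨t, ht, Subtype.ext ?_⟩, ⟨a, ha, Subtype.ext ?_⟩⟩
    · have : s.starProjection (perp ν a + t • ν) = t • ν := by
        rw [Submodule.starProjection_unit_singleton ℝ hν, perp_apply hν]
        simp [inner_add_right, inner_sub_right, inner_smul_right, hν]
      exact (LinearIsometryEquiv.toSpanUnitSingleton_apply (𝕜 := ℝ) ν hν t ▸ this.symm)
    · change perp ν a = perp ν (perp ν a + t • ν)
      simp only [perp_apply hν]
      simp [inner_add_right, inner_sub_right, inner_smul_right, hν]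
  · rintro ⟨⟨t, ht, h3⟩, a, ha, h4⟩
    refine ⟨a, ha, t, ht, ?_⟩
    have h3' : t • ν = s.starProjection z := congrArg Subtype.val h3
    have h4' : perp ν a = perp ν z := congrArg Subtype.val h4
    rw [h3', h4', perp, Submodule.starProjection_orthogonal_val, sub_add_cancel]

omit [FiniteDimensional ℝ E] in
lemma euclideanHausdorffMeasure_image_perp_le (ν : E) (d : ℕ) (A : Set E) :
    μHE[d] (perp ν '' A) ≤ μHE[d] A := by
  have h : LipschitzWith 1 (perp ν) := LipschitzWith.of_dist_le_mul fun x y => by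
    rw [dist_eq_norm, ← map_sub, NNReal.coe_one, one_mul, dist_eq_norm]
    exact norm_perp_le ν _
  have h1 := h.hausdorffMeasure_image_le (d := d) (by positivity) A
  rw [ENNReal.coe_one, ENNReal.one_rpow, one_mul] at h1
  rw [euclideanHausdorffMeasure_def, Measure.smul_apply, Measure.smul_apply, ENNReal.smul_def,
    ENNReal.smul_def, smul_eq_mul, smul_eq_mul]
  exact mul_le_mul' le_rfl h1

omit [FiniteDimensional ℝ E] in
lemma euclideanHausdorffMeasure_le_image_perp {ν : E} (d : ℕ) {A : Set E} {K : ℝ≥0}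
    (h : ∀ a ∈ A, ∀ b ∈ A, ‖a - b‖ ≤ K * ‖perp ν (a - b)‖) :
    μHE[d] A ≤ (K : ℝ≥0∞) ^ d * μHE[d] (perp ν '' A) := by
  have hK : AntilipschitzWith K fun a : A => perp ν a :=
    AntilipschitzWith.of_le_mul_dist fun a b => by
      rw [Subtype.dist_eq, dist_eq_norm, dist_eq_norm, ← map_sub]
      exact h a a.2 b b.2
  have h1 := hK.le_hausdorffMeasure_image (d := d) (by positivity) Set.univ
  have h2 : (μH[d] : Measure E) A = (μH[d] : Measure A) Set.univ := by
    rw [← isometry_subtype_coe.hausdorffMeasure_image (Or.inl (by positivity)) Set.univ,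
      Set.image_univ, Subtype.range_coe]
  rw [euclideanHausdorffMeasure_def, Measure.smul_apply, Measure.smul_apply, ENNReal.smul_def,
    ENNReal.smul_def, smul_eq_mul, smul_eq_mul, mul_left_comm, h2]
  gcongr
  rw [ENNReal.rpow_natCast] at h1
  refine h1.trans (le_of_eq ?_)
  congr 2
  ext; simp

end HyperplaneProjection

/-! ### Comparing measures locally -/

/-- If `μ` is carried by `S` and locally on `S` bounded by every multiple `K > 1` of `ν`, then
`μ ≤ ν`: a countable cover is made disjoint, and then `K` tends to `1`. -/
lemma MeasureTheory.Measure.le_of_locally_le_mul {X : Type*} [TopologicalSpace X]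
    [SecondCountableTopology X] [MeasurableSpace X] [OpensMeasurableSpace X] {μ ν : Measure X}
    {S : Set X} (hS : MeasurableSet S) (hμ : μ Sᶜ = 0)
    (h : ∀ K : ENNReal, 1 < K → ∀ x ∈ S, ∃ U : Set X, IsOpen U ∧ x ∈ U ∧
      ∀ A, MeasurableSet A → A ⊆ S ∩ U → μ A ≤ K * ν A) : μ ≤ ν := by
  have key : ∀ K : ENNReal, 1 < K → ∀ A, MeasurableSet A → μ A ≤ K * ν A := by
    intro K hK A hA
    have hAS : μ A = μ (A ∩ S) := (measure_inter_conull hμ).symm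
    rcases S.eq_empty_or_nonempty with rfl | hne
    · simp [hAS]
    choose! U hUo hxU hU using h K hK
    obtain ⟨t, htS, htc, hcov⟩ := TopologicalSpace.countable_cover_nhdsWithin
      (f := U) (s := S) fun x hx => mem_nhdsWithin_of_mem_nhds ((hUo x hx).mem_nhds (hxU x hx))
    have htne : t.Nonempty := by
      obtain ⟨x, hx⟩ := hne
      obtain ⟨y, hy, -⟩ := Set.mem_iUnion₂.1 (hcov hx)
      exact ⟨y, hy⟩
    obtain ⟨f, rfl⟩ := htc.exists_eq_range htne
    have hf : ∀ i, f i ∈ S := fun i => htS (Set.mem_range_self i)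
    let V : ℕ → Set X := fun i => A ∩ S ∩ disjointed (fun i => U (f i)) i
    have hVm : ∀ i, MeasurableSet (V i) := fun i =>
      (hA.inter hS).inter (MeasurableSet.disjointed (fun j => (hUo _ (hf j)).measurableSet) i)
    have hVd : Pairwise (Function.onFun Disjoint V) := fun i j hij =>
      (disjoint_disjointed _ hij).mono Set.inter_subset_right Set.inter_subset_right
    have hVU : ⋃ i, V i = A ∩ S := by
      rw [← Set.inter_iUnion, iUnion_disjointed, Set.inter_eq_left]
      intro x hx
      obtain ⟨y, ⟨i, rfl⟩, hy⟩ := Set.mem_iUnion₂.1 (hcov hx.2)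
      exact Set.mem_iUnion.2 ⟨i, hy⟩
    calc μ A = ∑' i, μ (V i) := by rw [hAS, ← hVU, measure_iUnion hVd hVm]
      _ ≤ ∑' i, K * ν (V i) := ENNReal.tsum_le_tsum fun i => hU _ (hf i) _ (hVm i)
          fun x hx => ⟨hx.1.2, disjointed_subset _ i hx.2⟩
      _ = K * ν (A ∩ S) := by rw [ENNReal.tsum_mul_left, ← hVU, measure_iUnion hVd hVm]
      _ ≤ K * ν A := by gcongr; exact Set.inter_subset_left
  refine Measure.le_iff.2 fun A hA => ?_
  by_cases htop : ν A = ⊤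
  · simp [htop]
  have hlim : Filter.Tendsto (fun K : ENNReal => K * ν A) (nhdsWithin 1 (Set.Ioi 1))
      (nhds (1 * ν A)) :=
    (ENNReal.Tendsto.mul_const Filter.tendsto_id (Or.inr htop)).mono_left nhdsWithin_le_nhds
  rw [one_mul] at hlim
  have : (nhdsWithin (1 : ENNReal) (Set.Ioi 1)).NeBot := ENNReal.nhdsGT_one_neBot
  exact ge_of_tendsto hlim (eventually_mem_nhdsWithin.mono fun K hK => key K hK A hA)

namespace Grushin

open HyperplaneProjection Filter
open scoped Topology RealInnerProductSpace ENNReal NNReal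

variable {m n : ℕ}

/-! ### Dilations and the gauge -/

@[simp] lemma dilation_inl (α r : ℝ) (z : Space m n) (i : Fin m) :
    dilation α r z (Sum.inl i) = r * z (Sum.inl i) := rfl

@[simp] lemma dilation_inr (α r : ℝ) (z : Space m n) (j : Fin n) :
    dilation α r z (Sum.inr j) = r ^ (α + 1) * z (Sum.inr j) := rfl

@[simp] lemma xPart_apply (z : Space m n) (i : Fin m) : xPart z i = z (Sum.inl i) := rfl

@[simp] lemma yPart_apply (z : Space m n) (j : Fin n) : yPart z j = z (Sum.inr j) := rfl

lemma xPart_dilation (α r : ℝ) (z : Space m n) : xPart (dilation α r z) = r • xPart z := by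
  ext i; simp

lemma yPart_dilation (α r : ℝ) (z : Space m n) :
    yPart (dilation α r z) = r ^ (α + 1) • yPart z := by
  ext i; simp

lemma norm_xPart_dilation (α : ℝ) {r : ℝ} (hr : 0 ≤ r) (z : Space m n) :
    ‖xPart (dilation α r z)‖ = r * ‖xPart z‖ := by
  rw [xPart_dilation, norm_smul, Real.norm_of_nonneg hr]

lemma norm_sq_eq_xPart_add_yPart (z : Space m n) :
    ‖z‖ ^ 2 = ‖xPart z‖ ^ 2 + ‖yPart z‖ ^ 2 := by
  simp [EuclideanSpace.norm_sq_eq]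

lemma dilation_one (α : ℝ) (z : Space m n) : dilation α 1 z = z := by
  ext (i | j) <;> simp

lemma dilation_dilation (α : ℝ) {r s : ℝ} (hr : 0 ≤ r) (hs : 0 ≤ s) (z : Space m n) :
    dilation α r (dilation α s z) = dilation α (r * s) z := by
  ext (i | j)
  · simp [mul_assoc]
  · simp [mul_assoc, Real.mul_rpow hr hs]

lemma dilation_zero_right (α r : ℝ) : dilation α r (0 : Space m n) = 0 := by
  ext (i | j) <;> simp

lemma continuous_dilation {α : ℝ} (hα : 0 ≤ α) :
    Continuous fun q : ℝ × Space m n => dilation α q.1 q.2 := by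
  refine (PiLp.continuous_toLp 2 _).comp (continuous_pi ?_)
  rintro (i | j)
  · simp only [Sum.elim_inl]; fun_prop
  · simp only [Sum.elim_inr]
    exact ((Real.continuous_rpow_const (by linarith)).comp continuous_fst).mul (by fun_prop)

lemma continuous_dilation_right (α r : ℝ) : Continuous fun z : Space m n => dilation α r z := by
  refine (PiLp.continuous_toLp 2 _).comp (continuous_pi ?_)
  rintro (i | j)
  · simp only [Sum.elim_inl]; fun_prop
  · simp only [Sum.elim_inr]; fun_prop

lemma continuous_xPart : Continuous (xPart : Space m n → _) :=
  (PiLp.continuous_toLp 2 _).comp (continuous_pi fun i => by fun_prop)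

lemma continuous_yPart : Continuous (yPart : Space m n → _) :=
  (PiLp.continuous_toLp 2 _).comp (continuous_pi fun i => by fun_prop)

/-- The polynomial-like function `|x|^{2(α+1)} + |y|²`, a power of the gauge which, unlike the
gauge itself, is `C¹` on the whole space. -/
def gaugePow (α : ℝ) (z : Space m n) : ℝ := ‖xPart z‖ ^ (2 * (α + 1)) + ‖yPart z‖ ^ 2

lemma gaugePow_nonneg (α : ℝ) (z : Space m n) : 0 ≤ gaugePow α z := by
  unfold gaugePow; positivity

lemma gauge_eq_gaugePow (α : ℝ) (z : Space m n) :
    gauge α z = gaugePow α z ^ (1 / (2 * (α + 1))) := rfl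

lemma gauge_nonneg (α : ℝ) (z : Space m n) : 0 ≤ gauge α z :=
  Real.rpow_nonneg (gaugePow_nonneg α z) _

variable {α : ℝ}

lemma gaugePow_eq_gauge_rpow (hα : 0 ≤ α) (z : Space m n) :
    gaugePow α z = gauge α z ^ (2 * (α + 1)) := by
  rw [gauge_eq_gaugePow, ← Real.rpow_mul (gaugePow_nonneg α z), one_div,
    inv_mul_cancel₀ (by positivity), Real.rpow_one]

lemma gaugePow_eq_zero_iff (hα : 0 ≤ α) {z : Space m n} : gaugePow α z = 0 ↔ z = 0 := by
  constructor
  · intro h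
    have h1 : 0 ≤ ‖xPart z‖ ^ (2 * (α + 1)) := by positivity
    have h2 : 0 ≤ ‖yPart z‖ ^ 2 := by positivity
    unfold gaugePow at h
    have h3 : ‖xPart z‖ ^ (2 * (α + 1)) = 0 := by linarith
    have h4 : ‖yPart z‖ ^ 2 = 0 := by linarith
    have h5 : ‖xPart z‖ = 0 := ((Real.rpow_eq_zero (norm_nonneg _) (by positivity)).1 h3)
    have := norm_sq_eq_xPart_add_yPart z
    rw [h4, h5] at this
    simpa using this
  · rintro rfl
    have hx : xPart (0 : Space m n) = 0 := by ext; simp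
    have hy : yPart (0 : Space m n) = 0 := by ext; simp
    unfold gaugePow
    rw [hx, hy, norm_zero, norm_zero, Real.zero_rpow (by positivity)]
    simp

lemma gauge_eq_zero_iff (hα : 0 ≤ α) {z : Space m n} : gauge α z = 0 ↔ z = 0 := by
  rw [← gaugePow_eq_zero_iff hα, gauge_eq_gaugePow,
    Real.rpow_eq_zero (gaugePow_nonneg α z) (by positivity)]

lemma gauge_pos (hα : 0 ≤ α) {z : Space m n} (hz : z ≠ 0) : 0 < gauge α z :=
  (gauge_nonneg α z).lt_of_ne' (mt (gauge_eq_zero_iff hα).1 hz)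

lemma gaugePow_dilation {r : ℝ} (hr : 0 ≤ r) (z : Space m n) :
    gaugePow α (dilation α r z) = r ^ (2 * (α + 1)) * gaugePow α z := by
  have : (r ^ (α + 1)) ^ 2 = r ^ (2 * (α + 1)) := by
    rw [← Real.rpow_natCast, ← Real.rpow_mul hr]; congr 1; push_cast; ring
  rw [gaugePow, norm_xPart_dilation α hr, yPart_dilation, norm_smul, mul_pow,
    Real.mul_rpow hr (norm_nonneg _), Real.norm_of_nonneg (by positivity), this, gaugePow]
  ring

lemma gauge_dilation (hα : 0 ≤ α) {r : ℝ} (hr : 0 ≤ r) (z : Space m n) :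
    gauge α (dilation α r z) = r * gauge α z := by
  rw [gauge_eq_gaugePow, gaugePow_dilation hr, Real.mul_rpow (by positivity) (gaugePow_nonneg α z),
    ← Real.rpow_mul hr, mul_one_div_cancel (by positivity), Real.rpow_one, gauge_eq_gaugePow]

lemma continuous_gaugePow (hα : 0 ≤ α) : Continuous (gaugePow α : Space m n → ℝ) :=
  ((Real.continuous_rpow_const (by positivity)).comp continuous_xPart.norm).add
    (continuous_yPart.norm.pow 2)

lemma continuous_gauge (hα : 0 ≤ α) : Continuous (gauge α : Space m n → ℝ) :=
  (Real.continuous_rpow_const (by positivity)).comp (continuous_gaugePow hα)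

lemma norm_xPart_le_gauge (hα : 0 ≤ α) (z : Space m n) : ‖xPart z‖ ≤ gauge α z := by
  rw [← Real.rpow_le_rpow_iff (norm_nonneg _) (gauge_nonneg _ _)
    (by positivity : 0 < 2 * (α + 1)), ← gaugePow_eq_gauge_rpow hα]
  exact le_add_of_nonneg_right (by positivity)

lemma norm_yPart_sq_le_gauge (hα : 0 ≤ α) (z : Space m n) :
    ‖yPart z‖ ^ 2 ≤ gauge α z ^ (2 * (α + 1)) := by
  rw [← gaugePow_eq_gauge_rpow hα]
  exact le_add_of_nonneg_left (by positivity)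

lemma isCompact_gauge_le (hα : 0 ≤ α) (r : ℝ) : IsCompact {z : Space m n | gauge α z ≤ r} := by
  refine Metric.isCompact_of_isClosed_isBounded
    (isClosed_le (continuous_gauge hα) continuous_const) ?_
  refine isBounded_iff_forall_norm_le.2 ⟨√(r ^ 2 + r ^ (2 * (α + 1))), fun z hz => ?_⟩
  have hz' : gauge α z ≤ r := hz
  refine Real.le_sqrt_of_sq_le ?_
  rw [norm_sq_eq_xPart_add_yPart]
  refine add_le_add (pow_le_pow_left₀ (norm_nonneg _) ((norm_xPart_le_gauge hα z).trans hz') 2) ?_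
  exact (norm_yPart_sq_le_gauge hα z).trans
    (Real.rpow_le_rpow (gauge_nonneg _ _) hz' (by positivity))

lemma isCompact_gaugeSphere (hα : 0 ≤ α) (r : ℝ) : IsCompact (gaugeSphere m n α r) :=
  (isCompact_gauge_le hα r).of_isClosed_subset
    (isClosed_eq (continuous_gauge hα) continuous_const) fun _ hz => le_of_eq hz

lemma measurableSet_gaugeSphere (hα : 0 ≤ α) (r : ℝ) : MeasurableSet (gaugeSphere m n α r) :=
  (isCompact_gaugeSphere hα r).measurableSet

lemma measurableSet_gaugeBall (hα : 0 ≤ α) (r : ℝ) : MeasurableSet (gaugeBall m n α r) :=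
  (isOpen_lt (continuous_gauge hα) continuous_const).measurableSet

lemma volume_gaugeBall_lt_top (hα : 0 ≤ α) (r : ℝ) : volume (gaugeBall m n α r) < ⊤ :=
  (measure_mono fun _ hz => (show gauge α _ < r from hz).le).trans_lt
    (isCompact_gauge_le hα r).measure_lt_top

lemma integrableOn_gaugeBall (hα : 0 ≤ α) {f : Space m n → ℝ} (hf : Continuous f) (r : ℝ) :
    IntegrableOn f (gaugeBall m n α r) :=
  (hf.continuousOn.integrableOn_compact (isCompact_gauge_le hα r)).mono_set
    fun _ hz => (show gauge α _ < r from hz).le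

/-- The dilation `δ_r` as a linear map. -/
def dilationLinear (α r : ℝ) : Space m n →ₗ[ℝ] Space m n where
  toFun := dilation α r
  map_add' z w := by ext (i | j) <;> simp [mul_add]
  map_smul' c z := by ext (i | j) <;> simp <;> ring

lemma det_dilationLinear {r : ℝ} (hr : 0 < r) :
    (dilationLinear α r : Space m n →ₗ[ℝ] Space m n).det = r ^ homDim m n α := by
  have h : LinearMap.toMatrix (EuclideanSpace.basisFun (Fin m ⊕ Fin n) ℝ).toBasis
      (EuclideanSpace.basisFun (Fin m ⊕ Fin n) ℝ).toBasis (dilationLinear α r)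
      = Matrix.diagonal (Sum.elim (fun _ => r) (fun _ => r ^ (α + 1))) := by
    ext k l
    rw [LinearMap.toMatrix_apply]
    rcases k with k | k <;> rcases l with l | l <;>
      simp [dilationLinear, Matrix.diagonal_apply, PiLp.single_apply]
  rw [← LinearMap.det_toMatrix (EuclideanSpace.basisFun (Fin m ⊕ Fin n) ℝ).toBasis, h,
    Matrix.det_diagonal, Fintype.prod_sum_type]
  simp only [Sum.elim_inl, Sum.elim_inr, Finset.prod_const, Finset.card_univ, Fintype.card_fin]
  rw [homDim, Real.rpow_add hr m, Real.rpow_natCast, mul_comm (n : ℝ), Real.rpow_mul hr.le,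
    Real.rpow_natCast]

lemma volume_preimage_dilation {r : ℝ} (hr : 0 < r) (s : Set (Space m n)) :
    volume (dilation α r ⁻¹' s) = ENNReal.ofReal (r ^ (-homDim m n α)) * volume s := by
  have h := Measure.addHaar_preimage_linearMap (volume : Measure (Space m n))
    (f := dilationLinear α r) (by rw [det_dilationLinear hr]; positivity) s
  rw [det_dilationLinear hr, ← Real.rpow_neg hr.le, abs_of_pos (by positivity)] at h
  exact h

lemma map_dilation_volume {r : ℝ} (hr : 0 < r) :
    Measure.map (dilation α r) (volume : Measure (Space m n))
      = ENNReal.ofReal (r ^ (-homDim m n α)) • volume := by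
  ext s hs
  rw [Measure.map_apply (continuous_dilation_right α r).measurable hs,
    volume_preimage_dilation hr, Measure.smul_apply, smul_eq_mul]

lemma homDim_pos (hm : 1 ≤ m) (hα : 0 ≤ α) : 0 < homDim m n α := by
  have : (1 : ℝ) ≤ m := by exact_mod_cast hm
  unfold homDim; positivity

lemma two_le_homDim (hm : 1 ≤ m) (hn : 1 ≤ n) (hα : 0 ≤ α) : 2 ≤ homDim m n α := by
  have h1 : (1 : ℝ) ≤ m := by exact_mod_cast hm
  have h2 : (1 : ℝ) ≤ n := by exact_mod_cast hn
  unfold homDim; nlinarith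

/-! ### Differentiability of the gauge -/

lemma contDiff_gaugePow (hα : 0 ≤ α) : ContDiff ℝ 1 (gaugePow α : Space m n → ℝ) := by
  have hx : ContDiff ℝ 1 (xPart : Space m n → _) := by
    rw [contDiff_euclidean]; intro i; simp only [xPart_apply]; fun_prop
  have hy : ContDiff ℝ 1 (yPart : Space m n → _) := by
    rw [contDiff_euclidean]; intro i; simp only [yPart_apply]; fun_prop
  exact (hx.norm_rpow (by linarith)).add (hy.norm_sq ℝ)

lemma contDiffAt_gauge (hα : 0 ≤ α) {z : Space m n} (hz : z ≠ 0) : ContDiffAt ℝ 1 (gauge α) z :=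
  (contDiff_gaugePow hα).contDiffAt.rpow_const_of_ne (mt (gaugePow_eq_zero_iff hα).1 hz)

/-- The coefficient field `(x, (α + 1) y)` of the generator of the dilations. -/
def eulerField (α : ℝ) (z : Space m n) : Space m n :=
  WithLp.toLp 2 (Sum.elim (fun i => z (Sum.inl i)) (fun j => (α + 1) * z (Sum.inr j)))

lemma fderiv_apply_eq_sum (u : Space m n → ℝ) (z v : Space m n) :
    fderiv ℝ u z v = ∑ i : Fin m, v (Sum.inl i) * partialDeriv (Sum.inl i) u z
      + ∑ j : Fin n, v (Sum.inr j) * partialDeriv (Sum.inr j) u z := by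
  have hv : v = ∑ k, v k • EuclideanSpace.single k (1 : ℝ) := by
    ext l; simp [Pi.single_apply, -Fintype.sum_sum_type]
  conv_lhs => rw [hv]
  rw [map_sum, Fintype.sum_sum_type]
  simp [partialDeriv]

lemma generator_eq_fderiv (u : Space m n → ℝ) (z : Space m n) :
    generator α u z = fderiv ℝ u z (eulerField α z) := by
  rw [fderiv_apply_eq_sum]; rfl

/-- The diagonal coefficients `(1, (α + 1)² |x|^{2α})` of the Baouendi-Grushin operator. -/
def coeff (α : ℝ) (k : Fin m ⊕ Fin n) (z : Space m n) : ℝ :=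
  Sum.elim (fun _ => 1) (fun _ => (α + 1) ^ 2 * ‖xPart z‖ ^ (2 * α)) k

lemma continuous_coeff (hα : 0 ≤ α) (k : Fin m ⊕ Fin n) :
    Continuous (coeff α k : Space m n → ℝ) := by
  rcases k with i | j
  · exact continuous_const
  · exact continuous_const.mul
      ((Real.continuous_rpow_const (by positivity)).comp continuous_xPart.norm)

lemma grushinLaplacian_eq_sum (u : Space m n → ℝ) (z : Space m n) :
    grushinLaplacian α u z = ∑ k, coeff α k z * partialDeriv k (partialDeriv k u) z := by
  simp [grushinLaplacian, coeff, Fintype.sum_sum_type, Finset.mul_sum]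

lemma norm_grushinGradient_sq (u : Space m n → ℝ) (z : Space m n) :
    ‖grushinGradient α u z‖ ^ 2 = ∑ k, coeff α k z * partialDeriv k u z ^ 2 := by
  have h : (‖xPart z‖ ^ α) ^ 2 = ‖xPart z‖ ^ (2 * α) := by
    rw [← Real.rpow_natCast, ← Real.rpow_mul (norm_nonneg _)]; congr 1; push_cast; ring
  simp [EuclideanSpace.norm_sq_eq, grushinGradient, coeff, Fintype.sum_sum_type, mul_pow, h]

lemma fderiv_gaugePow_apply (hα : 0 ≤ α) (z v : Space m n) :
    fderiv ℝ (gaugePow α) z v = 2 * (α + 1) * ‖xPart z‖ ^ (2 * α) * inner ℝ (xPart z) (xPart v)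
      + 2 * inner ℝ (yPart z) (yPart v) := by
  let X : Space m n →L[ℝ] EuclideanSpace ℝ (Fin m) :=
    LinearMap.toContinuousLinearMap
      { toFun := xPart, map_add' := fun a b => by ext; simp, map_smul' := fun c a => by ext; simp }
  let Y : Space m n →L[ℝ] EuclideanSpace ℝ (Fin n) :=
    LinearMap.toContinuousLinearMap
      { toFun := yPart, map_add' := fun a b => by ext; simp, map_smul' := fun c a => by ext; simp }
  have h1 : HasFDerivAt (fun z : Space m n => ‖X z‖ ^ (2 * (α + 1))) _ z :=
    (hasFDerivAt_norm_rpow (X z) (by linarith : 1 < 2 * (α + 1))).comp z X.hasFDerivAt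
  have h2 : HasFDerivAt (fun z : Space m n => ‖Y z‖ ^ 2) _ z := Y.hasFDerivAt.norm_sq
  have h3 : HasFDerivAt (gaugePow α) _ z := h1.add h2
  rw [h3.fderiv]
  have e : 2 * (α + 1) - 2 = 2 * α := by ring
  simp [e]
  rfl

/-- `A ∇ρ = ρ^{-(2α+1)} |x|^{2α} Z` where `A` is the coefficient matrix of the Baouendi-Grushin
operator: the conormal direction of the gauge spheres is the generator of the dilations. -/
lemma coeff_mul_partialDeriv_gauge (hα : 0 ≤ α) {z : Space m n} (hz : z ≠ 0)
    (k : Fin m ⊕ Fin n) :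
    coeff α k z * partialDeriv k (gauge α) z
      = gauge α z ^ (-(2 * α + 1)) * ‖xPart z‖ ^ (2 * α) * eulerField α z k := by
  have hF : 0 < gaugePow α z :=
    (gaugePow_nonneg α z).lt_of_ne' (mt (gaugePow_eq_zero_iff hα).1 hz)
  have h1 : HasFDerivAt (gaugePow α) (fderiv ℝ (gaugePow α) z) z :=
    ((contDiff_gaugePow hα).differentiable one_ne_zero z).hasFDerivAt
  have h2 := h1.rpow_const (p := 1 / (2 * (α + 1))) (Or.inl hF.ne')
  have h3 : fderiv ℝ (gauge α) z = _ := h2.fderiv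
  have h4 : gaugePow α z ^ (1 / (2 * (α + 1)) - 1) = gauge α z ^ (-(2 * α + 1)) := by
    rw [gaugePow_eq_gauge_rpow hα, ← Real.rpow_mul (gauge_nonneg _ _)]
    congr 1; field_simp; ring
  rw [partialDeriv, h3, smul_apply, fderiv_gaugePow_apply hα, h4]
  have hα' : α + 1 ≠ 0 := by positivity
  have key : inner ℝ (xPart z) (xPart (EuclideanSpace.single k (1 : ℝ))) =
      Sum.elim (fun i => z (Sum.inl i)) (fun _ => 0) k ∧
      inner ℝ (yPart z) (yPart (EuclideanSpace.single k (1 : ℝ))) =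
      Sum.elim (fun _ => 0) (fun j => z (Sum.inr j)) k := by
    rcases k with i | j <;> simp [PiLp.inner_apply, PiLp.single_apply]
  rw [key.1, key.2]
  rcases k with i | j
  · simp [coeff, eulerField]; field_simp
  · simp [coeff, eulerField]; field_simp

/-! ### Polar coordinates adapted to the gauge -/

/-- The projection `z ↦ δ_{1/ρ(z)} z` onto the unit gauge sphere (it sends `0` to `0`). -/
def radialProj (α : ℝ) (z : Space m n) : Space m n := dilation α (gauge α z)⁻¹ z

/-- The cone measure on the unit gauge sphere: `Q` times the image of Lebesgue measure on the unit
gauge ball under the radial projection. -/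
def coneMeasure (m n : ℕ) (α : ℝ) : Measure (Space m n) :=
  ENNReal.ofReal (homDim m n α) •
    Measure.map (radialProj α) (volume.restrict (gaugeBall m n α 1))

/-- The measure `s^{Q-1} ds` on `(0, ∞)`. -/
def radialMeasure (Q : ℝ) : Measure ℝ :=
  (volume.restrict (Set.Ioi 0)).withDensity fun s => ENNReal.ofReal (s ^ (Q - 1))

lemma measurable_radialProj (hα : 0 ≤ α) : Measurable (radialProj α : Space m n → Space m n) :=
  (continuous_dilation hα).measurable.comp
    ((continuous_gauge hα).measurable.inv.prodMk measurable_id)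

lemma dilation_gauge_radialProj (hα : 0 ≤ α) (z : Space m n) :
    dilation α (gauge α z) (radialProj α z) = z := by
  by_cases hz : z = 0
  · simp [radialProj, hz, dilation_zero_right]
  · have := gauge_pos hα hz
    rw [radialProj, dilation_dilation α this.le (by positivity), mul_inv_cancel₀ this.ne',
      dilation_one]

lemma gauge_radialProj (hα : 0 ≤ α) {z : Space m n} (hz : z ≠ 0) :
    gauge α (radialProj α z) = 1 := by
  have := gauge_pos hα hz
  rw [radialProj, gauge_dilation hα (by positivity), inv_mul_cancel₀ this.ne']

lemma radialProj_dilation (hα : 0 ≤ α) {r : ℝ} (hr : 0 < r) (z : Space m n) :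
    radialProj α (dilation α r z) = radialProj α z := by
  have := gauge_nonneg α z
  rw [radialProj, gauge_dilation hα hr.le, dilation_dilation α (by positivity) hr.le, radialProj]
  congr 1
  field_simp

lemma radialProj_of_mem {z : Space m n} (hz : z ∈ gaugeSphere m n α 1) : radialProj α z = z := by
  rw [radialProj, show gauge α z = 1 from hz, inv_one, dilation_one]

lemma dilation_ne_zero {r : ℝ} (hα : 0 ≤ α) (hr : 0 < r) {z : Space m n}
    (hz : z ∈ gaugeSphere m n α 1) : dilation α r z ≠ 0 := by
  refine mt (gauge_eq_zero_iff hα).2 ?_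
  rw [gauge_dilation hα hr.le, show gauge α z = 1 from hz]
  simpa using hr.ne'

lemma coneMeasure_apply (hα : 0 ≤ α) {s : Set (Space m n)} (hs : MeasurableSet s) :
    coneMeasure m n α s = ENNReal.ofReal (homDim m n α) *
      volume (radialProj α ⁻¹' s ∩ gaugeBall m n α 1) := by
  rw [coneMeasure, Measure.smul_apply, Measure.map_apply (measurable_radialProj hα) hs,
    Measure.restrict_apply (measurable_radialProj hα hs), smul_eq_mul]

lemma isFiniteMeasure_coneMeasure (hα : 0 ≤ α) : IsFiniteMeasure (coneMeasure m n α) where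
  measure_univ_lt_top := by
    rw [coneMeasure_apply hα MeasurableSet.univ]
    exact ENNReal.mul_lt_top ENNReal.ofReal_lt_top
      ((measure_mono Set.inter_subset_right).trans_lt (volume_gaugeBall_lt_top hα 1))

/-- The space is nontrivial as soon as `m ≥ 1`, so that points are null sets. -/
lemma ae_ne_zero (hm : 1 ≤ m) : ∀ᵐ z : Space m n, z ≠ 0 := by
  have : Nonempty (Fin m ⊕ Fin n) := ⟨Sum.inl ⟨0, hm⟩⟩
  exact compl_mem_ae_iff.2 (measure_singleton (0 : Space m n))

lemma coneMeasure_compl_gaugeSphere (hm : 1 ≤ m) (hα : 0 ≤ α) :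
    coneMeasure m n α (gaugeSphere m n α 1)ᶜ = 0 := by
  rw [coneMeasure_apply hα (measurableSet_gaugeSphere hα 1).compl]
  refine mul_eq_zero_of_right _ (measure_mono_null ?_ (ae_ne_zero (n := n) hm))
  rintro z ⟨hz, -⟩ hz0
  exact hz (gauge_radialProj hα hz0)

lemma ae_coneMeasure_mem (hm : 1 ≤ m) (hα : 0 ≤ α) :
    ∀ᵐ ω ∂coneMeasure m n α, ω ∈ gaugeSphere m n α 1 :=
  coneMeasure_compl_gaugeSphere hm hα

lemma radialMeasure_Ico {Q a b : ℝ} (hQ : 0 < Q) (ha : 0 ≤ a) (hab : a ≤ b) :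
    radialMeasure Q (Set.Ico a b) = ENNReal.ofReal ((b ^ Q - a ^ Q) / Q) := by
  have h1 : radialMeasure Q (Set.Ico a b)
      = ∫⁻ s in Set.Ioc a b, ENNReal.ofReal (s ^ (Q - 1)) := by
    rw [radialMeasure, withDensity_apply _ measurableSet_Ico,
      Measure.restrict_restrict measurableSet_Ico]
    refine setLIntegral_congr ?_
    have h2 : (Set.Ico a b ∩ Set.Ioi 0 : Set ℝ) =ᵐ[volume] (Set.Ioc a b ∩ Set.Ioi 0 : Set ℝ) :=
      (Ico_ae_eq_Ioc).inter (ae_eq_refl _)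
    refine h2.trans (ae_of_all _ fun x => propext ⟨fun h => h.1, fun h => ⟨h, ha.trans_lt h.1⟩⟩)
  have hint : IntervalIntegrable (fun s : ℝ => s ^ (Q - 1)) volume a b :=
    intervalIntegral.intervalIntegrable_rpow' (by linarith)
  rw [h1, ← ofReal_integral_eq_lintegral_ofReal, ← intervalIntegral.integral_of_le hab,
    integral_rpow (Or.inl (by linarith))]
  · simp
  · exact (intervalIntegrable_iff_integrableOn_Ioc_of_le hab).1 hint
  · filter_upwards [ae_restrict_mem measurableSet_Ioc] with s hs
    exact Real.rpow_nonneg (ha.trans hs.1.le) _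

lemma radialMeasure_Iio {Q r : ℝ} (hQ : 0 < Q) :
    radialMeasure Q (Set.Iio r) = ENNReal.ofReal (max r 0 ^ Q / Q) := by
  have h := radialMeasure_Ico (b := max r 0) hQ le_rfl (le_max_right r 0)
  rw [Real.zero_rpow hQ.ne', sub_zero] at h
  rw [← h, radialMeasure, withDensity_apply _ measurableSet_Iio,
    withDensity_apply _ measurableSet_Ico, Measure.restrict_restrict measurableSet_Iio,
    Measure.restrict_restrict measurableSet_Ico]
  congr 2
  ext x
  simp only [Set.mem_inter_iff, Set.mem_Iio, Set.mem_Ioi, Set.mem_Ico, lt_max_iff]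
  exact ⟨fun h => ⟨⟨h.2.le, Or.inl h.1⟩, h.2⟩,
    fun h => ⟨h.1.2.resolve_right (not_lt.2 h.1.1), h.2⟩⟩

lemma sigmaFinite_radialMeasure (Q : ℝ) : SigmaFinite (radialMeasure Q) := by
  unfold radialMeasure
  exact SigmaFinite.withDensity_ofReal _

/-- The volume of the part of `B_r` over a subset `A` of the unit sphere, by homogeneity. Both sides
vanish for `r ≤ 0`. -/
lemma volume_sector (hm : 1 ≤ m) (hα : 0 ≤ α) {A : Set (Space m n)} (hA : MeasurableSet A)
    (r : ℝ) :
    volume ({z | gauge α z < r} ∩ radialProj α ⁻¹' A)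
      = ENNReal.ofReal (max r 0 ^ homDim m n α / homDim m n α) * coneMeasure m n α A := by
  have hQ := homDim_pos (n := n) hm hα
  rcases le_or_gt r 0 with hr | hr
  · have : {z : Space m n | gauge α z < r} = ∅ := by
      ext z; simpa using hr.trans (gauge_nonneg α z)
    simp [this, max_eq_right hr, Real.zero_rpow hQ.ne']
  have h : {z : Space m n | gauge α z < r} ∩ radialProj α ⁻¹' A
      = dilation α r⁻¹ ⁻¹' (radialProj α ⁻¹' A ∩ gaugeBall m n α 1) := by
    ext z
    simp only [Set.mem_inter_iff, Set.mem_ofPred_eq, Set.mem_preimage, gaugeBall,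
      radialProj_dilation hα (inv_pos.2 hr), gauge_dilation hα (inv_pos.2 hr).le]
    rw [inv_mul_lt_one₀ hr, and_comm]
  rw [h, volume_preimage_dilation (inv_pos.2 hr), coneMeasure_apply hα hA, ← mul_assoc,
    ← ENNReal.ofReal_mul (by positivity), max_eq_left hr.le, Real.inv_rpow hr.le,
    Real.rpow_neg hr.le, inv_inv, div_mul_cancel₀ _ hQ.ne']

/-- Lebesgue measure is the product of `s^{Q-1} ds` and the cone measure in the coordinates
`(ρ(z), δ_{1/ρ(z)} z)`. -/
lemma map_polar_volume (hm : 1 ≤ m) (hα : 0 ≤ α) :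
    Measure.map (fun z : Space m n => (gauge α z, radialProj α z)) volume
      = (radialMeasure (homDim m n α)).prod (coneMeasure m n α) := by
  have hQ := homDim_pos (n := n) hm hα
  have := isFiniteMeasure_coneMeasure (m := m) (n := n) hα
  have hmeas : Measurable fun z : Space m n => (gauge α z, radialProj α z) :=
    (continuous_gauge hα).measurable.prodMk (measurable_radialProj hα)
  symm
  refine Measure.prod_eq_generateFrom
    ((borel_eq_generateFrom_Iio ℝ).symm.trans BorelSpace.measurable_eq.symm)
    MeasurableSpace.generateFrom_measurableSet isPiSystem_Iio
    MeasurableSpace.isPiSystem_measurableSet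
    ⟨fun k : ℕ => Set.Iio (k : ℝ), fun k => Set.mem_range_self _, fun k => ?_, ?_⟩
    (coneMeasure m n α).toFiniteSpanningSetsIn ?_
  · rw [radialMeasure_Iio hQ]; exact ENNReal.ofReal_lt_top
  · exact Set.iUnion_eq_univ_iff.2 exists_nat_gt
  · rintro _ ⟨r, rfl⟩ A hA
    rw [Measure.map_apply hmeas (measurableSet_Iio.prod hA), radialMeasure_Iio hQ]
    exact volume_sector hm hα hA r

/-- Integration in polar coordinates. -/
lemma integral_polar (hm : 1 ≤ m) (hα : 0 ≤ α) {f : Space m n → ℝ} (hf : Measurable f)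
    (hfi : Integrable f) :
    ∫ z, f z = ∫ s in Set.Ioi 0, s ^ (homDim m n α - 1) *
      ∫ ω, f (dilation α s ω) ∂coneMeasure m n α := by
  have := isFiniteMeasure_coneMeasure (m := m) (n := n) hα
  have := sigmaFinite_radialMeasure (homDim m n α)
  have hmeas : Measurable fun z : Space m n => (gauge α z, radialProj α z) :=
    (continuous_gauge hα).measurable.prodMk (measurable_radialProj hα)
  have hF : Measurable fun q : ℝ × Space m n => f (dilation α q.1 q.2) :=
    hf.comp (continuous_dilation hα).measurable
  have hint : Integrable (fun q : ℝ × Space m n => f (dilation α q.1 q.2))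
      ((radialMeasure (homDim m n α)).prod (coneMeasure m n α)) := by
    rw [← map_polar_volume hm hα, integrable_map_measure hF.aestronglyMeasurable hmeas.aemeasurable]
    refine hfi.congr (ae_of_all _ fun z => ?_)
    simp only [Function.comp_apply, dilation_gauge_radialProj hα]
  calc ∫ z, f z = ∫ z, f (dilation α (gauge α z) (radialProj α z)) := by
        simp only [dilation_gauge_radialProj hα]
    _ = ∫ q, f (dilation α q.1 q.2)
          ∂Measure.map (fun z : Space m n => (gauge α z, radialProj α z)) volume :=
        (integral_map hmeas.aemeasurable hF.aestronglyMeasurable).symm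
    _ = _ := by
      rw [map_polar_volume hm hα, integral_prod _ hint, radialMeasure,
        integral_withDensity_eq_integral_toReal_smul (by fun_prop)
          (ae_of_all _ fun _ => ENNReal.ofReal_lt_top)]
      refine setIntegral_congr_fun measurableSet_Ioi fun s hs => ?_
      simp only [smul_eq_mul]
      rw [ENNReal.toReal_ofReal (Real.rpow_nonneg (le_of_lt hs) _)]

/-! ### The surface measure of the unit gauge sphere -/

lemma hasDerivAt_dilation {r : ℝ} (hr : 0 < r) (z : Space m n) :
    HasDerivAt (fun s => dilation α s z) (r⁻¹ • eulerField α (dilation α r z)) r := by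
  refine (PiLp.continuousLinearEquiv 2 ℝ
    fun _ : Fin m ⊕ Fin n => ℝ).symm.hasFDerivAt.comp_hasDerivAt r
      (f' := (r⁻¹ • eulerField α (dilation α r z)).ofLp)
      (f := fun s => (dilation α s z).ofLp) (hasDerivAt_pi.2 ?_)
  rintro (i | j)
  · simp only [dilation_inl, eulerField, PiLp.smul_apply, Sum.elim_inl, smul_eq_mul]
    rw [inv_mul_cancel_left₀ hr.ne']
    simpa using (hasDerivAt_id r).mul_const (z (Sum.inl i))
  · simp only [dilation_inr, eulerField, PiLp.smul_apply, Sum.elim_inr, smul_eq_mul]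
    convert! (Real.hasDerivAt_rpow_const (p := α + 1) (Or.inl hr.ne')).mul_const (z (Sum.inr j))
      using 1
    rw [Real.rpow_sub hr, Real.rpow_one]
    field_simp

/-- Euler's identity for the gauge, on the unit sphere. -/
lemma fderiv_gauge_eulerField (hα : 0 ≤ α) {ω : Space m n} (hω : ω ∈ gaugeSphere m n α 1) :
    fderiv ℝ (gauge α) ω (eulerField α ω) = 1 := by
  have hω1 : gauge α ω = 1 := hω
  have h0 : ω ≠ 0 := by simpa [dilation_one] using dilation_ne_zero hα one_pos hω
  have h1 : HasFDerivAt (gauge α) (fderiv ℝ (gauge α) ω) (dilation α 1 ω) := by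
    rw [dilation_one]
    exact ((contDiffAt_gauge hα h0).differentiableAt one_ne_zero).hasFDerivAt
  have h2 := h1.comp_hasDerivAt 1 (hasDerivAt_dilation (α := α) one_pos ω)
  rw [dilation_one, inv_one, one_smul] at h2
  have h3 : (gauge α ∘ fun s => dilation α s ω) =ᶠ[𝓝 1] id := by
    filter_upwards [lt_mem_nhds one_pos] with s hs
    simp [gauge_dilation hα (le_of_lt hs), hω1]
  exact h2.unique ((hasDerivAt_id (1 : ℝ)).congr_of_eventuallyEq h3)

lemma norm_gradient_gauge_pos (hα : 0 ≤ α) {ω : Space m n} (hω : ω ∈ gaugeSphere m n α 1) :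
    0 < ‖gradient (gauge α) ω‖ := by
  refine norm_pos_iff.2 fun h => ?_
  have h1 := fderiv_gauge_eulerField hα hω
  rw [gradient, LinearIsometryEquiv.map_eq_zero_iff] at h
  simp [h] at h1

lemma inner_gradient (u : Space m n → ℝ) (z v : Space m n) :
    ⟪gradient u z, v⟫ = fderiv ℝ u z v := by
  rw [gradient, InnerProductSpace.toDual_symm_apply]

lemma hasStrictFDerivAt_gauge (hα : 0 ≤ α) {z : Space m n} (hz : z ≠ 0) :
    HasStrictFDerivAt (gauge α) (fderiv ℝ (gauge α) z) z :=
  (contDiffAt_gauge hα hz).hasStrictFDerivAt one_ne_zero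

lemma hasStrictFDerivAt_radialProj (hα : 0 ≤ α) {ω : Space m n} (hω : ω ∈ gaugeSphere m n α 1) :
    HasStrictFDerivAt (radialProj α) (ContinuousLinearMap.id ℝ (Space m n) -
      (fderiv ℝ (gauge α) ω).smulRight (eulerField α ω)) ω := by
  have hω1 : gauge α ω = 1 := hω
  have h0 : ω ≠ 0 := by simpa [dilation_one] using dilation_ne_zero hα one_pos hω
  have hg := hasStrictFDerivAt_gauge hα h0
  have hinv : HasStrictDerivAt (fun s : ℝ => s⁻¹) (-1) (gauge α ω) := by
    simpa [hω1] using hasStrictDerivAt_inv (x := gauge α ω) (by simp [hω1])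
  have hpow : HasStrictDerivAt (fun s : ℝ => s⁻¹ ^ (α + 1)) (-(α + 1)) (gauge α ω) := by
    have := (Real.hasStrictDerivAt_rpow_const (p := α + 1) (x := (gauge α ω)⁻¹)
      (Or.inl (by simp [hω1]))).comp (gauge α ω) hinv
    rw [hω1] at this ⊢
    simpa [Function.comp_def] using this
  rw [hasStrictFDerivAt_euclidean]
  rintro (i | j)
  · have hc : HasStrictFDerivAt (fun z : Space m n => z (Sum.inl i))
        (EuclideanSpace.proj (Sum.inl i) : Space m n →L[ℝ] ℝ) ω :=
      (EuclideanSpace.proj (𝕜 := ℝ) (Sum.inl i)).hasStrictFDerivAt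
    refine ((hinv.comp_hasStrictFDerivAt ω hg).mul hc).congr_fderiv ?_
    ext v
    simp [hω1, eulerField]
    ring
  · have hc : HasStrictFDerivAt (fun z : Space m n => z (Sum.inr j))
        (EuclideanSpace.proj (Sum.inr j) : Space m n →L[ℝ] ℝ) ω :=
      (EuclideanSpace.proj (𝕜 := ℝ) (Sum.inr j)).hasStrictFDerivAt
    refine ((hpow.comp_hasStrictFDerivAt ω hg).mul hc).congr_fderiv ?_
    ext v
    simp [hω1, eulerField]
    ring

/-- The unit normal of the gauge sphere at `ω`. -/
def unitNormal (α : ℝ) (ω : Space m n) : Space m n :=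
  ‖gradient (gauge α) ω‖⁻¹ • gradient (gauge α) ω

lemma norm_unitNormal (hα : 0 ≤ α) {ω : Space m n} (hω : ω ∈ gaugeSphere m n α 1) :
    ‖unitNormal α ω‖ = 1 := by
  have := norm_gradient_gauge_pos hα hω
  rw [unitNormal, norm_smul, norm_inv, norm_norm, inv_mul_cancel₀ this.ne']

lemma fderiv_gauge_eq_inner (hα : 0 ≤ α) {ω : Space m n} (hω : ω ∈ gaugeSphere m n α 1)
    (v : Space m n) :
    fderiv ℝ (gauge α) ω v = ‖gradient (gauge α) ω‖ * ⟪unitNormal α ω, v⟫ := by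
  have := norm_gradient_gauge_pos hα hω
  rw [unitNormal, real_inner_smul_left, mul_inv_cancel_left₀ this.ne', inner_gradient]

/-- A chart straightening the gauge sphere near `ω`: it sends the sector over a subset `A` of the
sphere to a right cylinder over the projection of `A` to the tangent plane at `ω`. Taking
`ρ^Q / Q` rather than `ρ` as height makes the volume of the sector over `A` exactly the cone
measure of `A` times the height of the cylinder. -/
def flattening (α : ℝ) (ω z : Space m n) : Space m n :=
  perp (unitNormal α ω) (radialProj α z)
    + (gauge α z ^ homDim m n α / homDim m n α) • unitNormal α ω

/-- The derivative of `flattening α ω` at `ω` is `v ↦ v + ⟪ν, v⟫ b` with `⟪ν, b⟫ = |∇ρ(ω)| - 1`,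
so that its determinant is `1 + ⟪ν, b⟫ = |∇ρ(ω)|`. -/
lemma exists_hasStrictFDerivAt_flattening (hm : 1 ≤ m) (hα : 0 ≤ α) {ω : Space m n}
    (hω : ω ∈ gaugeSphere m n α 1) :
    ∃ L : Space m n →L[ℝ] Space m n, HasStrictFDerivAt (flattening α ω) L ω ∧
      L.det = ‖gradient (gauge α) ω‖ := by
  have hω1 : gauge α ω = 1 := hω
  have h0 : ω ≠ 0 := by simpa [dilation_one] using dilation_ne_zero hα one_pos hω
  have hQ := homDim_pos (n := n) hm hα
  set ν := unitNormal α ω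
  set κ := ‖gradient (gauge α) ω‖
  have hν : ‖ν‖ = 1 := norm_unitNormal hα hω
  have hg := hasStrictFDerivAt_gauge hα h0
  have hpow : HasStrictDerivAt (fun s : ℝ => s ^ homDim m n α / homDim m n α) 1 (gauge α ω) := by
    have := (Real.hasStrictDerivAt_rpow_const (p := homDim m n α) (x := gauge α ω)
      (Or.inl (by simp [hω1]))).div_const (homDim m n α)
    simpa [hω1, hQ.ne'] using this
  have h1 := (((perp ν).hasStrictFDerivAt).comp ω (hasStrictFDerivAt_radialProj hα hω)).add
    ((hpow.comp_hasStrictFDerivAt ω hg).smul_const ν)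
  refine ⟨_, h1, ?_⟩
  set b : Space m n := κ • (ν - perp ν (eulerField α ω)) - ν
  have hdet : (perp ν ∘L (ContinuousLinearMap.id ℝ (Space m n) -
      (fderiv ℝ (gauge α) ω).smulRight (eulerField α ω))
      + ((1 : ℝ) • fderiv ℝ (gauge α) ω).smulRight ν).toLinearMap
      = LinearMap.transvection (innerₛₗ ℝ ν) b := by
    refine LinearMap.ext fun v => ?_
    simp only [LinearMap.transvection.apply, b]
    have e1 : perp ν v = v - ⟪ν, v⟫ • ν := perp_apply hν v
    simp [fderiv_gauge_eq_inner hα hω, -Submodule.starProjection_orthogonal_val, e1]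
    simp only [smul_sub, smul_smul, κ, ν, mul_comm]
    abel
  rw [ContinuousLinearMap.det, hdet, LinearMap.transvection.det]
  simp [b, perp_apply hν, inner_sub_right, inner_smul_right, hν]

/-- The sector `{a ≤ ρ < b}` over the set `A`. -/
def sector (α a b : ℝ) (A : Set (Space m n)) : Set (Space m n) :=
  {z | gauge α z ∈ Set.Ico a b ∧ radialProj α z ∈ A}

lemma volume_sector_Ico (hm : 1 ≤ m) (hα : 0 ≤ α) {a b : ℝ} (ha : 0 ≤ a) (hab : a ≤ b)
    {A : Set (Space m n)} (hA : MeasurableSet A) :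
    volume (sector α a b A)
      = ENNReal.ofReal ((b ^ homDim m n α - a ^ homDim m n α) / homDim m n α)
        * coneMeasure m n α A := by
  have hmeas : Measurable fun z : Space m n => (gauge α z, radialProj α z) :=
    (continuous_gauge hα).measurable.prodMk (measurable_radialProj hα)
  have := isFiniteMeasure_coneMeasure (m := m) (n := n) hα
  rw [← radialMeasure_Ico (homDim_pos hm hα) ha hab, ← Measure.prod_prod,
    ← map_polar_volume hm hα, Measure.map_apply hmeas (measurableSet_Ico.prod hA)]
  rfl

lemma volume_image_flattening (hm : 1 ≤ m) (hα : 0 ≤ α) {a b : ℝ} (ha : 0 < a) (hab : a ≤ b)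
    {ω : Space m n} (hω : ω ∈ gaugeSphere m n α 1) {A : Set (Space m n)}
    (hAS : A ⊆ gaugeSphere m n α 1) :
    volume (flattening α ω '' sector α a b A)
      = ENNReal.ofReal ((b ^ homDim m n α - a ^ homDim m n α) / homDim m n α)
        * μHE[m + n - 1] (perp (unitNormal α ω) '' A) := by
  have hQ := homDim_pos (n := n) hm hα
  have hd : Module.finrank ℝ (Space m n) = m + n := by simp
  have hc := volume_cylinder (norm_unitNormal hα hω) A
    (Set.Ico (a ^ homDim m n α / homDim m n α) (b ^ homDim m n α / homDim m n α))
  rw [hd, Real.volume_Ico, ← sub_div] at hc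
  rw [← hc]
  congr 1
  ext y
  simp only [Set.mem_image, sector, Set.mem_ofPred_eq]
  constructor
  · rintro ⟨z, ⟨⟨h1, h2⟩, h3⟩, rfl⟩
    refine ⟨_, h3, gauge α z ^ homDim m n α / homDim m n α, ⟨?_, ?_⟩, rfl⟩
    · gcongr
    · have := gauge_nonneg α z
      gcongr
  · rintro ⟨w, hw, t, ⟨h1, h2⟩, rfl⟩
    have hQt : 0 ≤ homDim m n α * t := by
      have : 0 ≤ t := le_trans (by positivity) h1
      positivity
    set s := (homDim m n α * t) ^ (homDim m n α)⁻¹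
    have hsQ : s ^ homDim m n α = homDim m n α * t := Real.rpow_inv_rpow hQt hQ.ne'
    have hs0 : 0 ≤ s := Real.rpow_nonneg hQt _
    have has : a ≤ s := by
      rw [← Real.rpow_le_rpow_iff ha.le hs0 hQ, hsQ]
      rwa [div_le_iff₀' hQ] at h1
    have hsb : s < b := by
      rw [← Real.rpow_lt_rpow_iff hs0 (ha.le.trans hab) hQ, hsQ]
      rwa [lt_div_iff₀' hQ] at h2
    have hs : 0 < s := ha.trans_le has
    have hg : gauge α (dilation α s w) = s := by
      rw [gauge_dilation hα hs0, show gauge α w = 1 from hAS hw, mul_one]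
    have hp : radialProj α (dilation α s w) = w := by
      rw [radialProj_dilation hα hs, radialProj_of_mem (hAS hw)]
    refine ⟨dilation α s w, ⟨⟨hg.symm ▸ has, hg.symm ▸ hsb⟩, hp.symm ▸ hw⟩, ?_⟩
    rw [flattening, hg, hp, hsQ, mul_div_cancel_left₀ _ hQ.ne']

/-- Thin sectors over small pieces of the sphere are contained in small neighbourhoods. -/
lemma exists_sector_subset (hα : 0 ≤ α) {ω : Space m n} {O : Set (Space m n)} (hO : O ∈ 𝓝 ω) :
    ∃ U : Set (Space m n), IsOpen U ∧ ω ∈ U ∧ ∃ a b : ℝ, 0 < a ∧ a < b ∧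
      ∀ A ⊆ U, sector α a b A ⊆ O := by
  have hcont : Tendsto (fun q : ℝ × Space m n => dilation α q.1 q.2) (𝓝 (1, ω)) (𝓝 ω) := by
    have := (continuous_dilation (m := m) (n := n) hα).tendsto (1, ω)
    rwa [dilation_one] at this
  obtain ⟨T, V, hTo, h1T, hVo, hωV, hTV⟩ := mem_nhds_prod_iff'.1 (hcont hO)
  obtain ⟨ε, hε, hball⟩ := Metric.isOpen_iff.1 hTo 1 h1T
  refine ⟨V, hVo, hωV, 1, 1 + ε, one_pos, by linarith, ?_⟩
  rintro A hA z ⟨⟨h1, h2⟩, h3⟩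
  have hT : gauge α z ∈ T := hball <| by
    rw [Metric.mem_ball, Real.dist_eq, abs_lt]
    constructor <;> linarith
  rw [← dilation_gauge_radialProj hα z]
  exact hTV (Set.mk_mem_prod hT (hA h3))

/-- Near `ω`, the surface measure is at most `c` times the cone measure if `c > |∇ρ(ω)|`. -/
lemma exists_nhds_hausdorff_le (hm : 1 ≤ m) (hα : 0 ≤ α) {ω : Space m n}
    (hω : ω ∈ gaugeSphere m n α 1) {c : ℝ≥0} (hc : ‖gradient (gauge α) ω‖ < c) :
    ∃ U : Set (Space m n), IsOpen U ∧ ω ∈ U ∧ ∀ A, MeasurableSet A → A ⊆ gaugeSphere m n α 1 ∩ U →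
      μHE[m + n - 1] A ≤ c * coneMeasure m n α A := by
  have h0 : ω ≠ 0 := by simpa [dilation_one] using dilation_ne_zero hα one_pos hω
  have hQ := homDim_pos (n := n) hm hα
  obtain ⟨κ, hκeq⟩ : ∃ κ : ℝ≥0, ‖gradient (gauge α) ω‖ = κ := ⟨‖gradient (gauge α) ω‖₊, rfl⟩
  have hκ : (0 : ℝ) < κ := hκeq ▸ norm_gradient_gauge_pos hα hω
  rw [hκeq] at hc
  set ν := unitNormal α ω
  have hν : ‖ν‖ = 1 := norm_unitNormal hα hω
  obtain ⟨L, hL, hdet⟩ := exists_hasStrictFDerivAt_flattening hm hα hω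
  obtain ⟨c', hc1, hc2⟩ := exists_between (NNReal.coe_lt_coe.1 hc)
  -- a Lipschitz constant `K > 1` with `K ^ (N - 1) * c' ≤ c`
  obtain ⟨K, hK, hKc⟩ : ∃ K : ℝ≥0, 1 < K ∧ K ^ (m + n - 1) * c' ≤ c := by
    have hlim : Tendsto (fun K : ℝ≥0 => K ^ (m + n - 1) * c') (𝓝[>] 1) (𝓝 (1 ^ (m + n - 1) * c')) :=
      Tendsto.mono_left (Continuous.tendsto (by fun_prop) 1) nhdsWithin_le_nhds
    rw [one_pow, one_mul] at hlim
    obtain ⟨K, h1, h2⟩ := ((hlim.eventually (gt_mem_nhds hc2)).and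
      (eventually_mem_nhdsWithin)).exists
    exact ⟨K, h2, h1.le⟩
  have hK0 : (0 : ℝ) < K := zero_lt_one.trans (by exact_mod_cast hK)
  obtain ⟨δ, hδ, hδpos⟩ := ((addHaar_image_le_mul_of_det_lt (volume : Measure (Space m n)) L
    (m := c') (by
      rw [hdet, hκeq, abs_of_pos hκ, ENNReal.ofReal_coe_nnreal]; exact_mod_cast hc1)).and
      self_mem_nhdsWithin).exists
  obtain ⟨O, hO, hOL⟩ := hL.approximates_deriv_on_nhds (c := δ) (Or.inr hδpos)
  obtain ⟨U, hUo, hωU, a, b, ha, hab, hsec⟩ := exists_sector_subset hα hO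
  -- chords of the sphere near `ω` are tangential up to the fraction `1 - 1 / K` of their length, so
  -- that the projection to the tangent plane shrinks them at most by the factor `K`
  obtain ⟨V, hV, hVL⟩ := (hasStrictFDerivAt_gauge hα h0).approximates_deriv_on_nhds
    (c := κ * (1 - K⁻¹)) (Or.inr (by
      have : K⁻¹ < 1 := inv_lt_one_of_one_lt₀ hK
      exact mul_pos (by exact_mod_cast hκ) (tsub_pos_of_lt this)))
  obtain ⟨V', hV'V, hV'o, hωV'⟩ := mem_nhds_iff.1 hV
  refine ⟨U ∩ V', hUo.inter hV'o, ⟨hωU, hωV'⟩, fun A hA hAS => ?_⟩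
  have hlip : ∀ x ∈ A, ∀ y ∈ A, ‖x - y‖ ≤ K * ‖perp ν (x - y)‖ := by
    intro x hx y hy
    have h1 := hVL x (hV'V (hAS hx).2.2) y (hV'V (hAS hy).2.2)
    rw [show gauge α x = 1 from (hAS hx).1, show gauge α y = 1 from (hAS hy).1, sub_self, zero_sub,
      norm_neg, fderiv_gauge_eq_inner hα hω, norm_mul, norm_norm, hκeq] at h1
    have hK1 : ((1 - K⁻¹ : ℝ≥0) : ℝ) = 1 - (K : ℝ)⁻¹ := by
      rw [NNReal.coe_sub (inv_le_one_of_one_le₀ hK.le)]; simp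
    rw [NNReal.coe_mul, hK1, mul_assoc] at h1
    have h2 : ‖⟪ν, x - y⟫‖ ≤ (1 - (K : ℝ)⁻¹) * ‖x - y‖ :=
      le_of_mul_le_mul_left h1 hκ
    have h3 : ‖x - y‖ ≤ ‖perp ν (x - y)‖ + ‖⟪ν, x - y⟫‖ := by
      have : x - y = perp ν (x - y) + ⟪ν, x - y⟫ • ν := by
        rw [perp_apply hν, sub_add_cancel]
      calc ‖x - y‖ = ‖perp ν (x - y) + ⟪ν, x - y⟫ • ν‖ := by rw [← this]
        _ ≤ _ := (norm_add_le _ _).trans_eq (by rw [norm_smul, hν, mul_one])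
    have h4 : (K : ℝ)⁻¹ * ‖x - y‖ ≤ ‖perp ν (x - y)‖ := by linarith
    rwa [inv_mul_le_iff₀ hK0] at h4
  have hsub := hsec A fun x hx => (hAS hx).2.1
  have h1 := hδ _ _ (hOL.mono_set hsub)
  rw [volume_image_flattening hm hα ha hab.le hω fun x hx => (hAS hx).1,
    volume_sector_Ico hm hα ha.le hab.le hA, mul_left_comm] at h1
  have hI : 0 < (b ^ homDim m n α - a ^ homDim m n α) / homDim m n α := by
    have := Real.rpow_lt_rpow ha.le hab hQ
    exact div_pos (by linarith) hQ
  rw [ENNReal.mul_le_mul_iff_right (ENNReal.ofReal_pos.2 hI).ne' ENNReal.ofReal_ne_top] at h1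
  calc μHE[m + n - 1] A ≤ (K : ℝ≥0∞) ^ (m + n - 1) * μHE[m + n - 1] (perp ν '' A) :=
        euclideanHausdorffMeasure_le_image_perp _ hlip
    _ ≤ (K : ℝ≥0∞) ^ (m + n - 1) * (c' * coneMeasure m n α A) := by gcongr
    _ = ((K ^ (m + n - 1) * c' : ℝ≥0) : ℝ≥0∞) * coneMeasure m n α A := by
        rw [← mul_assoc]; push_cast; rfl
    _ ≤ c * coneMeasure m n α A := by gcongr

/-- Near `ω`, the surface measure is at least `c` times the cone measure if `c < |∇ρ(ω)|`. -/
lemma exists_nhds_le_hausdorff (hm : 1 ≤ m) (hα : 0 ≤ α) {ω : Space m n}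
    (hω : ω ∈ gaugeSphere m n α 1) {c : ℝ≥0} (hc : c < ‖gradient (gauge α) ω‖) :
    ∃ U : Set (Space m n), IsOpen U ∧ ω ∈ U ∧ ∀ A, MeasurableSet A → A ⊆ gaugeSphere m n α 1 ∩ U →
      c * coneMeasure m n α A ≤ μHE[m + n - 1] A := by
  have hQ := homDim_pos (n := n) hm hα
  obtain ⟨L, hL, hdet⟩ := exists_hasStrictFDerivAt_flattening hm hα hω
  obtain ⟨δ, hδ, hδpos⟩ := ((mul_le_addHaar_image_of_lt_det (volume : Measure (Space m n)) L
    (m := c) (by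
      rw [hdet, abs_of_nonneg (norm_nonneg _), ← ENNReal.ofReal_coe_nnreal]
      exact (ENNReal.ofReal_lt_ofReal_iff_of_nonneg c.2).2 hc)).and self_mem_nhdsWithin).exists
  obtain ⟨O, hO, hOL⟩ := hL.approximates_deriv_on_nhds (c := δ) (Or.inr hδpos)
  obtain ⟨U, hUo, hωU, a, b, ha, hab, hsec⟩ := exists_sector_subset hα hO
  refine ⟨U, hUo, hωU, fun A hA hAS => ?_⟩
  have h1 := hδ _ _ (hOL.mono_set (hsec A fun x hx => (hAS hx).2))
  rw [volume_image_flattening hm hα ha hab.le hω fun x hx => (hAS hx).1,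
    volume_sector_Ico hm hα ha.le hab.le hA, mul_left_comm] at h1
  have hI : 0 < (b ^ homDim m n α - a ^ homDim m n α) / homDim m n α := by
    have := Real.rpow_lt_rpow ha.le hab hQ
    exact div_pos (by linarith) hQ
  rw [ENNReal.mul_le_mul_iff_right (ENNReal.ofReal_pos.2 hI).ne' ENNReal.ofReal_ne_top] at h1
  exact h1.trans (euclideanHausdorffMeasure_image_perp_le _ _ _)

lemma measurable_norm_gradient (u : Space m n → ℝ) : Measurable fun z => ‖gradient u z‖ := by
  have h : (fun z => ‖gradient u z‖) = fun z => ‖fderiv ℝ u z‖ := by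
    ext z; rw [gradient, LinearIsometryEquiv.norm_map]
  rw [h]
  exact (measurable_fderiv ℝ u).norm

lemma continuousAt_norm_gradient_gauge (hα : 0 ≤ α) {ω : Space m n}
    (hω : ω ∈ gaugeSphere m n α 1) : ContinuousAt (fun z => ‖gradient (gauge α) z‖) ω := by
  have h0 : ω ≠ 0 := by simpa [dilation_one] using dilation_ne_zero hα one_pos hω
  have h : (fun z : Space m n => ‖gradient (gauge α) z‖) = fun z => ‖fderiv ℝ (gauge α) z‖ := by
    ext z; rw [gradient, LinearIsometryEquiv.norm_map]
  rw [h]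
  exact ((contDiffAt_gauge hα h0).continuousAt_fderiv one_ne_zero).norm

/-- The coarea factor: surface measure on the unit gauge sphere is `|∇ρ|` times the cone measure. -/
theorem surfaceMeasure_eq_withDensity (hm : 1 ≤ m) (hα : 0 ≤ α) :
    surfaceMeasure m n α
      = (coneMeasure m n α).withDensity fun z => ENNReal.ofReal ‖gradient (gauge α) z‖ := by
  have hS := measurableSet_gaugeSphere (m := m) (n := n) hα 1
  have hσ : ∀ A, MeasurableSet A → A ⊆ gaugeSphere m n α 1 →
      surfaceMeasure m n α A = μHE[m + n - 1] A := fun A hA hAS => by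
    rw [surfaceMeasure, Measure.restrict_apply hA, Set.inter_eq_left.2 hAS]
  have hσc : surfaceMeasure m n α (gaugeSphere m n α 1)ᶜ = 0 := by
    rw [surfaceMeasure, Measure.restrict_apply hS.compl, Set.compl_inter_self, measure_empty]
  have hsqrt : ∀ K : ℝ≥0∞, 1 < K → ∃ k : ℝ≥0, 1 < k ∧ (k : ℝ≥0∞) * k ≤ K := fun K hK => by
    obtain ⟨k, h1, h2⟩ := ENNReal.lt_iff_exists_nnreal_btwn.1 hK
    refine ⟨NNReal.sqrt k, by
      rw [← NNReal.sqrt_one]; exact NNReal.sqrt_lt_sqrt.2 (by exact_mod_cast h1), ?_⟩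
    rw [← ENNReal.coe_mul, NNReal.mul_self_sqrt]
    exact h2.le
  refine le_antisymm (Measure.le_of_locally_le_mul hS hσc fun K hK ω hω => ?_)
    (Measure.le_of_locally_le_mul hS
      (withDensity_absolutelyContinuous _ _ (coneMeasure_compl_gaugeSphere hm hα))
      fun K hK ω hω => ?_)
  all_goals
    obtain ⟨k, hk, hkK⟩ := hsqrt K hK
    have hk0 : (0 : ℝ) < k := zero_lt_one.trans (by exact_mod_cast hk)
    have hκ := norm_gradient_gauge_pos hα hω
    have hcont := continuousAt_norm_gradient_gauge hα hω
    obtain ⟨κ, hκeq⟩ : ∃ κ : ℝ≥0, ‖gradient (gauge α) ω‖ = κ := ⟨‖gradient (gauge α) ω‖₊, rfl⟩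
    have hlt : ((κ / k : ℝ≥0) : ℝ) < ‖gradient (gauge α) ω‖ := by
      rw [hκeq] at hκ ⊢
      push_cast
      exact div_lt_self hκ (by exact_mod_cast hk)
    have hgt : ‖gradient (gauge α) ω‖ < (κ * k : ℝ≥0) := by
      rw [hκeq] at hκ ⊢
      push_cast
      exact lt_mul_of_one_lt_right hκ (by exact_mod_cast hk)
    have hkk : (k : ℝ≥0∞) * k * (κ / k : ℝ≥0) = (κ * k : ℝ≥0) := by
      rw [← ENNReal.coe_mul, ← ENNReal.coe_mul]
      congr 1
      have : k ≠ 0 := (zero_lt_one.trans hk).ne'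
      field_simp
  · obtain ⟨U, hUo, hωU, hU⟩ := exists_nhds_hausdorff_le hm hα hω hgt
    obtain ⟨V, hV, hVo, hωV⟩ := mem_nhds_iff.1 (hcont.eventually (lt_mem_nhds hlt))
    refine ⟨U ∩ V, hUo.inter hVo, ⟨hωU, hωV⟩, fun A hA hAS => ?_⟩
    rw [hσ A hA fun x hx => (hAS hx).1, withDensity_apply _ hA]
    calc μHE[m + n - 1] A ≤ (κ * k : ℝ≥0) * coneMeasure m n α A :=
          hU A hA fun x hx => ⟨(hAS hx).1, (hAS hx).2.1⟩
      _ = k * k * ((κ / k : ℝ≥0) * coneMeasure m n α A) := by rw [← mul_assoc, hkk]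
      _ ≤ K * ((κ / k : ℝ≥0) * coneMeasure m n α A) := by gcongr
      _ ≤ _ := by
        gcongr
        rw [← setLIntegral_const]
        refine setLIntegral_mono' hA fun x hx => ?_
        rw [← ENNReal.ofReal_coe_nnreal]
        exact ENNReal.ofReal_le_ofReal (le_of_lt (hV (hAS hx).2.2))
  · obtain ⟨U, hUo, hωU, hU⟩ := exists_nhds_le_hausdorff hm hα hω hlt
    obtain ⟨V, hV, hVo, hωV⟩ := mem_nhds_iff.1 (hcont.eventually (gt_mem_nhds hgt))
    refine ⟨U ∩ V, hUo.inter hVo, ⟨hωU, hωV⟩, fun A hA hAS => ?_⟩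
    rw [hσ A hA fun x hx => (hAS hx).1, withDensity_apply _ hA]
    calc _ ≤ (κ * k : ℝ≥0) * coneMeasure m n α A := by
          rw [← setLIntegral_const]
          refine setLIntegral_mono' hA fun x hx => ?_
          rw [← ENNReal.ofReal_coe_nnreal]
          exact ENNReal.ofReal_le_ofReal (le_of_lt (hV (hAS hx).2.2))
      _ = k * k * ((κ / k : ℝ≥0) * coneMeasure m n α A) := by rw [← mul_assoc, hkk]
      _ ≤ k * k * μHE[m + n - 1] A := by
        gcongr
        exact hU A hA fun x hx => ⟨(hAS hx).1, (hAS hx).2.1⟩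
      _ ≤ K * μHE[m + n - 1] A := by gcongr

/-- Functions divided by `|∇ρ|` are integrated over the sphere against the cone measure. -/
lemma integral_surfaceMeasure (hm : 1 ≤ m) (hα : 0 ≤ α) (f g : Space m n → ℝ)
    (hfg : ∀ ω, f ω * ‖gradient (gauge α) ω‖ = g ω ∨ ω ∉ gaugeSphere m n α 1) :
    ∫ z, f z ∂surfaceMeasure m n α = ∫ z, g z ∂coneMeasure m n α := by
  rw [surfaceMeasure_eq_withDensity hm hα, integral_withDensity_eq_integral_toReal_smul
    (measurable_norm_gradient _).ennreal_ofReal (ae_of_all _ fun _ => ENNReal.ofReal_lt_top)]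
  refine integral_congr_ae ?_
  filter_upwards [ae_coneMeasure_mem (n := n) hm hα] with ω hω
  rw [ENNReal.toReal_ofReal (norm_nonneg _), smul_eq_mul, mul_comm]
  exact (hfg ω).resolve_right (not_not.2 hω)

lemma integrable_coneMeasure (hm : 1 ≤ m) (hα : 0 ≤ α) {g : Space m n → ℝ} (hg : Continuous g) :
    Integrable g (coneMeasure m n α) := by
  have := isFiniteMeasure_coneMeasure (m := m) (n := n) hα
  have h : (coneMeasure m n α).restrict (gaugeSphere m n α 1) = coneMeasure m n α :=
    Measure.restrict_eq_self_of_ae_mem (ae_coneMeasure_mem hm hα)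
  rw [← h]
  exact hg.continuousOn.integrableOn_compact (isCompact_gaugeSphere hα 1)

lemma integrable_surfaceMeasure (hm : 1 ≤ m) (hα : 0 ≤ α) {f g : Space m n → ℝ}
    (hg : Continuous g)
    (hfg : ∀ ω, f ω * ‖gradient (gauge α) ω‖ = g ω ∨ ω ∉ gaugeSphere m n α 1) :
    Integrable f (surfaceMeasure m n α) := by
  rw [surfaceMeasure_eq_withDensity hm hα, integrable_withDensity_iff_integrable_smul'
    (measurable_norm_gradient _).ennreal_ofReal (ae_of_all _ fun _ => ENNReal.ofReal_lt_top)]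
  refine (integrable_coneMeasure hm hα hg).congr ?_
  filter_upwards [ae_coneMeasure_mem (n := n) hm hα] with ω hω
  rw [ENNReal.toReal_ofReal (norm_nonneg _), smul_eq_mul, mul_comm]
  exact ((hfg ω).resolve_right (not_not.2 hω)).symm

/-! ### Differentiation along the dilations -/

/-- Differentiation under the integral sign for a measure carried by a compact set. -/
lemma hasDerivAt_integral_of_compact {X : Type*} [TopologicalSpace X] [MeasurableSpace X]
    [OpensMeasurableSpace X] {μ : Measure X} [IsFiniteMeasure μ] {K : Set X}
    (hK : IsCompact K) (hμ : ∀ᵐ x ∂μ, x ∈ K) {F F' : ℝ → X → ℝ} {r : ℝ} (hr : 0 < r)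
    (hF : ∀ s, 0 < s → Continuous (F s))
    (hF' : ContinuousOn (Function.uncurry F') (Set.Ioi 0 ×ˢ Set.univ))
    (hd : ∀ s, 0 < s → ∀ x, HasDerivAt (fun t => F t x) (F' s x) s)
    (hFi : Integrable (F r) μ) :
    HasDerivAt (fun s => ∫ x, F s x ∂μ) (∫ x, F' r x ∂μ) r := by
  have hsub : Set.Icc (r / 2) (2 * r) ×ˢ K ⊆ Set.Ioi 0 ×ˢ Set.univ :=
    Set.prod_mono (fun s hs => (half_pos hr).trans_le hs.1) (Set.subset_univ _)
  obtain ⟨C, hC⟩ := (isCompact_Icc.prod hK).exists_bound_of_continuousOn (hF'.mono hsub)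
  have hs : Set.Ioo (r / 2) (2 * r) ∈ 𝓝 r := Ioo_mem_nhds (by linarith) (by linarith)
  have hpos : ∀ s ∈ Set.Ioo (r / 2) (2 * r), 0 < s := fun s hs => (half_pos hr).trans hs.1
  have hF'r : Continuous (F' r) :=
    hF'.comp_continuous (f := fun x => (r, x)) (by fun_prop) fun x => ⟨hr, trivial⟩
  refine (hasDerivAt_integral_of_dominated_loc_of_deriv_le (bound := fun _ => C) hs ?_ hFi
    hF'r.measurable.aestronglyMeasurable ?_ (integrable_const C) ?_).2
  · filter_upwards [hs] with s hs'
    exact (hF s (hpos s hs')).measurable.aestronglyMeasurable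
  · filter_upwards [hμ] with x hx s hs'
    exact hC (s, x) ⟨⟨hs'.1.le, hs'.2.le⟩, hx⟩
  · exact ae_of_all _ fun x s hs' => hd s (hpos s hs') x

lemma hasDerivAt_comp_dilation {u : Space m n → ℝ} (hu : Differentiable ℝ u) {r : ℝ} (hr : 0 < r)
    (z : Space m n) :
    HasDerivAt (fun s => u (dilation α s z)) (r⁻¹ * generator α u (dilation α r z)) r := by
  have h := (hu (dilation α r z)).hasFDerivAt.comp_hasDerivAt r (hasDerivAt_dilation hr z)
  rw [map_smul, smul_eq_mul, ← generator_eq_fderiv] at h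
  exact h

lemma continuous_eulerField : Continuous (eulerField α : Space m n → Space m n) := by
  refine (PiLp.continuous_toLp 2 _).comp (continuous_pi ?_)
  rintro (i | j)
  · simp only [Sum.elim_inl]; fun_prop
  · simp only [Sum.elim_inr]; fun_prop

lemma continuous_partialDeriv {u : Space m n → ℝ} (hu : ContDiff ℝ 1 u) (k : Fin m ⊕ Fin n) :
    Continuous (partialDeriv k u) :=
  (hu.continuous_fderiv one_ne_zero).clm_apply continuous_const

lemma continuous_generator {u : Space m n → ℝ} (hu : ContDiff ℝ 1 u) :
    Continuous (generator α u) := by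
  simp only [funext fun z => generator_eq_fderiv (α := α) u z]
  exact (hu.continuous_fderiv one_ne_zero).clm_apply continuous_eulerField

lemma contDiff_partialDeriv {u : Space m n → ℝ} (hu : ContDiff ℝ 2 u) (k : Fin m ⊕ Fin n) :
    ContDiff ℝ 1 (partialDeriv k u) :=
  (hu.fderiv_right (by norm_num)).clm_apply contDiff_const

lemma contDiff_generator {u : Space m n → ℝ} (hu : ContDiff ℝ 2 u) :
    ContDiff ℝ 1 (generator α u) := by
  simp only [funext fun z => generator_eq_fderiv (α := α) u z]
  refine (hu.fderiv_right (by norm_num)).clm_apply (contDiff_euclidean.2 ?_)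
  rintro (i | j)
  · simp only [eulerField, Sum.elim_inl]; fun_prop
  · simp only [eulerField, Sum.elim_inr]; fun_prop

/-- The weights `1` of the variables `x_i` and `α + 1` of the variables `y_j`. -/
def weight (α : ℝ) (k : Fin m ⊕ Fin n) : ℝ := Sum.elim (fun _ => 1) (fun _ => α + 1) k

/-- The commutator of a partial derivative with the generator of the dilations. -/
lemma partialDeriv_generator {u : Space m n → ℝ} (hu : ContDiff ℝ 2 u) (k : Fin m ⊕ Fin n)
    (z : Space m n) :
    partialDeriv k (generator α u) z
      = weight α k * partialDeriv k u z + generator α (partialDeriv k u) z := by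
  have hd : HasFDerivAt (fderiv ℝ u) (fderiv ℝ (fderiv ℝ u) z) z :=
    ((hu.fderiv_right (m := 1) (by norm_num)).differentiable one_ne_zero z).hasFDerivAt
  let L : Space m n →L[ℝ] Space m n := LinearMap.toContinuousLinearMap
    { toFun := eulerField α
      map_add' := fun a b => by ext (i | j) <;> simp [eulerField, mul_add]
      map_smul' := fun c a => by ext (i | j) <;> simp [eulerField, mul_left_comm] }
  have h1 : HasFDerivAt (generator α u) _ z :=
    (hd.clm_apply (L.hasFDerivAt (x := z))).congr_of_eventuallyEq
      (Eventually.of_forall fun z => generator_eq_fderiv u z)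
  have h2 : HasFDerivAt (partialDeriv k u) _ z :=
    hd.clm_apply (hasFDerivAt_const (EuclideanSpace.single k (1 : ℝ)) z)
  have hsymm : fderiv ℝ (fderiv ℝ u) z (EuclideanSpace.single k 1) (eulerField α z)
      = fderiv ℝ (fderiv ℝ u) z (eulerField α z) (EuclideanSpace.single k 1) :=
    (hu.contDiffAt.isSymmSndFDerivAt (by simp)) _ _
  have hL : L (EuclideanSpace.single k 1) = weight α k • EuclideanSpace.single k (1 : ℝ) := by
    rcases k with k | k <;> ext (i | j) <;>
      simp [L, eulerField, weight]
  rw [partialDeriv, h1.fderiv, generator_eq_fderiv (u := partialDeriv k u), h2.fderiv]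
  simp only [add_apply, ContinuousLinearMap.comp_apply,
    ContinuousLinearMap.flip_apply, hL, map_smul, smul_eq_mul]
  have hLz : L z = eulerField α z := rfl
  rw [hLz, hsymm]
  simp [partialDeriv]

/-! ### The derivative of the scaled energy -/

/-- The function `2u/(p-1) + Zu`, the derivative of the rescaled functions `u_r` at `r = 1`. -/
def scalingDeriv (α p : ℝ) (u : Space m n → ℝ) (z : Space m n) : ℝ :=
  2 / (p - 1) * u z + generator α u z

/-- The density `|∇_α u|²/2 - |u|^{p+1}/(p+1)` of the energy. -/
def energyDensity (α p : ℝ) (u : Space m n → ℝ) (z : Space m n) : ℝ :=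
  1 / 2 * ∑ k, coeff α k z * partialDeriv k u z ^ 2 - 1 / (p + 1) * |u z| ^ (p + 1)

/-- The density of the first variation of the energy at `u` in the direction `w`. -/
def firstVariation (α p : ℝ) (u w : Space m n → ℝ) (z : Space m n) : ℝ :=
  ∑ k, coeff α k z * partialDeriv k u z * partialDeriv k w z - |u z| ^ (p - 1) * u z * w z

variable {p : ℝ} {u : Space m n → ℝ}

lemma contDiff_scalingDeriv (hu : ContDiff ℝ 2 u) : ContDiff ℝ 1 (scalingDeriv α p u) :=
  (contDiff_const.mul (hu.of_le (by norm_num))).add (contDiff_generator hu)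

lemma continuous_energyDensity (hα : 0 ≤ α) (hp : 1 < p) (hu : ContDiff ℝ 2 u) :
    Continuous (energyDensity α p u) := by
  have h1 := fun k => continuous_partialDeriv (hu.of_le (by norm_num)) k
  have h2 := fun k => continuous_coeff (m := m) (n := n) hα k
  have h3 : Continuous fun z => |u z| ^ (p + 1) :=
    (Real.continuous_rpow_const (by linarith)).comp hu.continuous.abs
  exact (continuous_const.mul (continuous_finsetSum _ fun k _ => (h2 k).mul ((h1 k).pow 2))).sub
    (continuous_const.mul h3)

lemma continuous_firstVariation (hα : 0 ≤ α) (hp : 1 < p) (hu : ContDiff ℝ 2 u)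
    {w : Space m n → ℝ} (hw : ContDiff ℝ 1 w) : Continuous (firstVariation α p u w) := by
  have h1 := fun k => continuous_partialDeriv (hu.of_le (by norm_num)) k
  have h2 := fun k => continuous_coeff (m := m) (n := n) hα k
  have h3 : Continuous fun z => |u z| ^ (p - 1) :=
    (Real.continuous_rpow_const (by linarith)).comp hu.continuous.abs
  exact (continuous_finsetSum _ fun k _ => ((h2 k).mul (h1 k)).mul
    (continuous_partialDeriv hw k)).sub ((h3.mul hu.continuous).mul hw.continuous)

/-- `A` is homogeneous of degree `0` in the `x`-directions and `2α` in the `y`-directions. Along the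
dilations its entries are differentiable even at `x = 0`. -/
lemma hasDerivAt_coeff_dilation (k : Fin m ⊕ Fin n) {r : ℝ} (hr : 0 < r) (z : Space m n) :
    HasDerivAt (fun s => coeff α k (dilation α s z))
      (r⁻¹ * (2 * (weight α k - 1) * coeff α k (dilation α r z))) r := by
  rcases k with i | j
  · simpa [coeff, weight] using hasDerivAt_const r (1 : ℝ)
  · have h1 : (fun s => coeff α (Sum.inr j : Fin m ⊕ Fin n) (dilation α s z)) =ᶠ[𝓝 r]
        fun s => s ^ (2 * α) * ((α + 1) ^ 2 * ‖xPart z‖ ^ (2 * α)) := by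
      filter_upwards [lt_mem_nhds hr] with s hs
      simp only [coeff, Sum.elim_inr]
      rw [norm_xPart_dilation α (le_of_lt hs), Real.mul_rpow (le_of_lt hs) (norm_nonneg _)]
      ring
    refine (((Real.hasDerivAt_rpow_const (p := 2 * α) (Or.inl hr.ne')).mul_const
      ((α + 1) ^ 2 * ‖xPart z‖ ^ (2 * α))).congr_of_eventuallyEq h1).congr_deriv ?_
    rw [h1.eq_of_nhds, Real.rpow_sub hr, Real.rpow_one]
    simp only [weight, Sum.elim_inr]
    field_simp
    ring

/-- The energy density of the rescaled function, seen as a function of the scale, has the first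
variation in the direction `scalingDeriv` as its derivative. -/
lemma hasDerivAt_energyDensity_dilation (hp : 1 < p) (hu : ContDiff ℝ 2 u) {r : ℝ} (hr : 0 < r)
    (z : Space m n) :
    HasDerivAt (fun s => s ^ (2 * (p + 1) / (p - 1)) * energyDensity α p u (dilation α s z))
      (r ^ (2 * (p + 1) / (p - 1) - 1)
        * firstVariation α p u (scalingDeriv α p u) (dilation α r z)) r := by
  have hp1 : p - 1 ≠ 0 := by linarith
  have hp2 : p + 1 ≠ 0 := by linarith
  have hd : ∀ k, Differentiable ℝ (partialDeriv k u) := fun k =>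
    (contDiff_partialDeriv hu k).differentiable one_ne_zero
  have hw : ∀ k z, partialDeriv k (scalingDeriv α p u) z = 2 / (p - 1) * partialDeriv k u z
      + (weight α k * partialDeriv k u z + generator α (partialDeriv k u) z) := fun k z => by
    rw [← partialDeriv_generator hu]
    have h1 : HasFDerivAt u (fderiv ℝ u z) z := (hu.differentiable two_ne_zero z).hasFDerivAt
    have h2 : HasFDerivAt (generator α u) (fderiv ℝ (generator α u) z) z :=
      ((contDiff_generator hu).differentiable one_ne_zero z).hasFDerivAt
    have h3 : HasFDerivAt (scalingDeriv α p u) _ z := (h1.const_mul (2 / (p - 1))).add h2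
    rw [partialDeriv, h3.fderiv]
    simp [partialDeriv]
  have hpow := Real.hasDerivAt_rpow_const (p := 2 * (p + 1) / (p - 1)) (Or.inl hr.ne')
  have hgrad := HasDerivAt.fun_sum (u := Finset.univ) fun (k : Fin m ⊕ Fin n) _ =>
    (hasDerivAt_coeff_dilation (α := α) k hr z).mul
      ((hasDerivAt_comp_dilation (α := α) (hd k) hr z).pow 2)
  have habs := (hasDerivAt_abs_rpow (u (dilation α r z)) (p := p + 1) (by linarith)).comp r
    (hasDerivAt_comp_dilation (α := α) (hu.differentiable two_ne_zero) hr z)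
  refine (hpow.mul ((hgrad.const_mul (1 / 2)).sub (habs.const_mul (1 / (p + 1))))).congr_deriv ?_
  have e1 : r ^ (2 * (p + 1) / (p - 1)) = r * r ^ (2 * (p + 1) / (p - 1) - 1) := by
    rw [Real.rpow_sub hr, Real.rpow_one]; field_simp
  have e2 : p + 1 - 2 = p - 1 := by ring
  have e3 : |u (dilation α r z)| ^ (p + 1) =
      |u (dilation α r z)| ^ (p - 1) * u (dilation α r z) ^ 2 := by
    rw [← sq_abs, ← Real.rpow_natCast, ← Real.rpow_add' (abs_nonneg _) (by push_cast; linarith)]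
    congr 1; push_cast; ring
  simp only [Pi.mul_apply, Pi.pow_apply, Pi.sub_apply, Function.comp_apply, firstVariation, hw]
  rw [e1, e2, e3]
  generalize dilation α r z = ζ
  simp only [scalingDeriv]
  -- half of the exponent is `(p + 1) / (p - 1) = 2 / (p - 1) + 1`, and together with
  -- `weight k - 1` from the coefficient it gives the factor `2 / (p - 1) + weight k` on the left
  have hsum : ∀ k : Fin m ⊕ Fin n,
      coeff α k ζ * partialDeriv k u ζ * (2 / (p - 1) * partialDeriv k u ζ
        + (weight α k * partialDeriv k u ζ + generator α (partialDeriv k u) ζ))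
      = 2 * (p + 1) / (p - 1) * (1 / 2 * (coeff α k ζ * partialDeriv k u ζ ^ 2))
        + r * (1 / 2 * (r⁻¹ * (2 * (weight α k - 1) * coeff α k ζ) * partialDeriv k u ζ ^ 2
          + coeff α k ζ * (2 * partialDeriv k u ζ ^ (2 - 1)
            * (r⁻¹ * generator α (partialDeriv k u) ζ)))) := fun k => by
    field_simp
    ring
  have hS : ∑ k : Fin m ⊕ Fin n,
      coeff α k ζ * partialDeriv k u ζ * (2 / (p - 1) * partialDeriv k u ζ
        + (weight α k * partialDeriv k u ζ + generator α (partialDeriv k u) ζ))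
      = 2 * (p + 1) / (p - 1) * (1 / 2 * ∑ k, coeff α k ζ * partialDeriv k u ζ ^ 2)
        + r * (1 / 2 * ∑ k, (r⁻¹ * (2 * (weight α k - 1) * coeff α k ζ) * partialDeriv k u ζ ^ 2
          + coeff α k ζ * (2 * partialDeriv k u ζ ^ (2 - 1)
            * (r⁻¹ * generator α (partialDeriv k u) ζ)))) := by
    simp only [Finset.mul_sum, ← Finset.sum_add_distrib]
    exact Finset.sum_congr rfl fun k _ => hsum k
  rw [hS]
  push_cast
  field_simp
  ring

lemma setIntegral_comp_dilation (hα : 0 ≤ α) {r : ℝ} (hr : 0 < r) {f : Space m n → ℝ}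
    (hf : Continuous f) :
    ∫ z in gaugeBall m n α 1, f (dilation α r z)
      = r ^ (-homDim m n α) * ∫ z in gaugeBall m n α r, f z := by
  have h1 := integral_map (μ := (volume : Measure (Space m n)))
    (continuous_dilation_right (m := m) (n := n) α r).measurable.aemeasurable
    (f := (gaugeBall m n α r).indicator f)
    (hf.measurable.indicator (measurableSet_gaugeBall hα r)).aestronglyMeasurable
  rw [map_dilation_volume hr, integral_smul_measure, ENNReal.toReal_ofReal (by positivity),
    integral_indicator (measurableSet_gaugeBall hα r), smul_eq_mul] at h1
  rw [h1, ← integral_indicator (measurableSet_gaugeBall hα 1)]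
  congr 1
  ext z
  have : dilation α r z ∈ gaugeBall m n α r ↔ z ∈ gaugeBall m n α 1 := by
    simp only [gaugeBall, Set.mem_ofPred_eq, gauge_dilation hα hr.le]
    exact mul_lt_iff_lt_one_right hr
  by_cases hz : z ∈ gaugeBall m n α 1
  · rw [Set.indicator_of_mem hz, Set.indicator_of_mem (this.2 hz)]
  · rw [Set.indicator_of_notMem hz, Set.indicator_of_notMem (mt this.1 hz)]

lemma integrableOn_gradient (hα : 0 ≤ α) (hu : ContDiff ℝ 2 u) (r : ℝ) :
    IntegrableOn (fun z => ‖grushinGradient α u z‖ ^ 2) (gaugeBall m n α r) := by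
  simp only [norm_grushinGradient_sq]
  exact integrableOn_gaugeBall hα (continuous_finsetSum _ fun k _ => (continuous_coeff hα k).mul
    ((continuous_partialDeriv (hu.of_le (by norm_num)) k).pow 2)) r

lemma integrableOn_power (hα : 0 ≤ α) (hp : 1 < p) (hu : Continuous u) (r : ℝ) :
    IntegrableOn (fun z => |u z| ^ (p + 1)) (gaugeBall m n α r) :=
  integrableOn_gaugeBall hα ((Real.continuous_rpow_const (by linarith)).comp hu.abs) r

lemma energy_eq_setIntegral (hα : 0 ≤ α) (hp : 1 < p) (hu : ContDiff ℝ 2 u) {r : ℝ} (hr : 0 < r) :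
    energy α p r u = ∫ z in gaugeBall m n α 1,
      r ^ (2 * (p + 1) / (p - 1)) * energyDensity α p u (dilation α r z) := by
  rw [integral_const_mul, setIntegral_comp_dilation hα hr (continuous_energyDensity hα hp hu),
    ← mul_assoc, ← Real.rpow_add hr, ← sub_eq_add_neg, energy, ← integral_const_mul,
    ← integral_const_mul, ← integral_sub ((integrableOn_gradient hα hu r).const_mul _)
      ((integrableOn_power hα hp hu.continuous r).const_mul _)]
  simp only [energyDensity, norm_grushinGradient_sq]

/-- The derivative of the energy, before any integration by parts: the energy is an integral over
the fixed ball `B_1`, and the derivative of the integrand is rescaled back to `B_r`. -/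
lemma hasDerivAt_energy (hα : 0 ≤ α) (hp : 1 < p) (hu : ContDiff ℝ 2 u) {r : ℝ} (hr : 0 < r) :
    HasDerivAt (fun s => energy α p s u)
      (r ^ (2 * (p + 1) / (p - 1) - 1 - homDim m n α) *
        ∫ z in gaugeBall m n α r, firstVariation α p u (scalingDeriv α p u) z) r := by
  have hfv := continuous_firstVariation hα hp hu (contDiff_scalingDeriv (α := α) (p := p) hu)
  have hfin : IsFiniteMeasure (volume.restrict (gaugeBall m n α 1)) :=
    ⟨by rw [Measure.restrict_apply_univ]; exact volume_gaugeBall_lt_top hα 1⟩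
  have hmem : ∀ᵐ z ∂volume.restrict (gaugeBall m n α 1), z ∈ {z : Space m n | gauge α z ≤ 1} := by
    filter_upwards [ae_restrict_mem (measurableSet_gaugeBall hα 1)] with z hz
    exact (show gauge α z < 1 from hz).le
  have hcont : ∀ s, Continuous fun z => s ^ (2 * (p + 1) / (p - 1)) *
      energyDensity α p u (dilation α s z) := fun s =>
    continuous_const.mul ((continuous_energyDensity hα hp hu).comp (continuous_dilation_right α s))
  have h := hasDerivAt_integral_of_compact (isCompact_gauge_le hα 1) hmem hr
    (fun s _ => hcont s)
    (F' := fun s z => s ^ (2 * (p + 1) / (p - 1) - 1)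
        * firstVariation α p u (scalingDeriv α p u) (dilation α s z)) ?_
    (fun s hs z => hasDerivAt_energyDensity_dilation hp hu hs z)
    (integrableOn_gaugeBall hα (hcont r) 1)
  · refine (h.congr_of_eventuallyEq ?_).congr_deriv ?_
    · filter_upwards [lt_mem_nhds hr] with s hs
      exact energy_eq_setIntegral hα hp hu hs
    · rw [integral_const_mul, setIntegral_comp_dilation hα hr hfv, ← mul_assoc, ← Real.rpow_add hr,
        ← sub_eq_add_neg]
  · refine ContinuousOn.mul (ContinuousOn.rpow_const continuousOn_fst fun q hq => Or.inl ?_)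
      (hfv.comp (continuous_dilation hα)).continuousOn
    exact (show 0 < q.1 from hq.1).ne'

/-! ### Green's formula on gauge balls -/

/-- The integral of `f` over the gauge sphere of radius `s`, against the cone measure. -/
def sphereIntegral (α : ℝ) (f : Space m n → ℝ) (s : ℝ) : ℝ :=
  ∫ ω, f (dilation α s ω) ∂coneMeasure m n α

lemma continuous_sphereIntegral (hm : 1 ≤ m) (hα : 0 ≤ α) {f : Space m n → ℝ}
    (hf : Continuous f) : Continuous (sphereIntegral α f) := by
  have := isFiniteMeasure_coneMeasure (m := m) (n := n) hα
  have h : (coneMeasure m n α).restrict (gaugeSphere m n α 1) = coneMeasure m n α :=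
    Measure.restrict_eq_self_of_ae_mem (ae_coneMeasure_mem hm hα)
  have h2 := continuous_parametric_integral_of_continuous (μ := coneMeasure m n α)
    (f := fun s ω => f (dilation α s ω)) (hf.comp (continuous_dilation hα))
    (isCompact_gaugeSphere hα 1)
  rw [h] at h2
  exact h2

/-- Polar coordinates for the product of a radial function, vanishing for `ρ ≥ R`, with a
continuous one. -/
lemma integral_radial_mul (hm : 1 ≤ m) (hα : 0 ≤ α) {f : Space m n → ℝ} (hf : Continuous f)
    {φ : ℝ → ℝ} (hφ : Measurable φ) (hi : Integrable fun z => φ (gauge α z) * f z) {R : ℝ}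
    (hR : 0 ≤ R) (hφR : ∀ s, R ≤ s → φ s = 0) :
    ∫ z, φ (gauge α z) * f z
      = ∫ s in (0 : ℝ)..R, φ s * (s ^ (homDim m n α - 1) * sphereIntegral α f s) := by
  have hmeas : Measurable fun z => φ (gauge α z) * f z :=
    (hφ.comp (continuous_gauge hα).measurable).mul hf.measurable
  rw [integral_polar hm hα hmeas hi, intervalIntegral.integral_of_le hR]
  have h1 : ∀ s ∈ Set.Ioi (0 : ℝ), s ^ (homDim m n α - 1) *
      ∫ ω, φ (gauge α (dilation α s ω)) * f (dilation α s ω) ∂coneMeasure m n α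
      = φ s * (s ^ (homDim m n α - 1) * sphereIntegral α f s) := fun s hs => by
    have h2 : ∫ ω, φ (gauge α (dilation α s ω)) * f (dilation α s ω) ∂coneMeasure m n α
        = φ s * sphereIntegral α f s := by
      rw [sphereIntegral, ← integral_const_mul]
      refine integral_congr_ae ?_
      filter_upwards [ae_coneMeasure_mem (n := n) hm hα] with ω hω
      rw [gauge_dilation hα (le_of_lt hs), show gauge α ω = 1 from hω, mul_one]
    rw [h2]; ring
  rw [setIntegral_congr_fun measurableSet_Ioi h1]
  refine (setIntegral_eq_of_subset_of_forall_sdiff_eq_zero measurableSet_Ioi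
    Set.Ioc_subset_Ioi_self fun s hs => ?_)
  have : R ≤ s := le_of_lt (not_le.1 fun h => hs.2 ⟨hs.1, h⟩)
  rw [hφR s this, zero_mul]

lemma setIntegral_gaugeBall (hm : 1 ≤ m) (hα : 0 ≤ α) {f : Space m n → ℝ} (hf : Continuous f)
    {r : ℝ} (hr : 0 ≤ r) :
    ∫ z in gaugeBall m n α r, f z
      = ∫ s in (0 : ℝ)..r, s ^ (homDim m n α - 1) * sphereIntegral α f s := by
  have h1 : (fun z => (Set.Iio r).indicator (fun _ => (1 : ℝ)) (gauge α z) * f z)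
      = (gaugeBall m n α r).indicator f := by
    ext z
    by_cases hz : gauge α z < r
    · rw [Set.indicator_of_mem (show gauge α z ∈ Set.Iio r from hz),
        Set.indicator_of_mem (show z ∈ gaugeBall m n α r from hz), one_mul]
    · rw [Set.indicator_of_notMem (show gauge α z ∉ Set.Iio r from hz),
        Set.indicator_of_notMem (show z ∉ gaugeBall m n α r from hz), zero_mul]
  have hball := measurableSet_gaugeBall (m := m) (n := n) hα r
  rw [← integral_indicator hball, ← h1]
  refine (integral_radial_mul hm hα hf (φ := (Set.Iio r).indicator fun _ => (1 : ℝ))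
    (measurable_const.indicator measurableSet_Iio) ?_ hr fun s hs =>
      Set.indicator_of_notMem (show s ∉ Set.Iio r from not_lt.2 hs) _).trans ?_
  rotate_left
  · refine intervalIntegral.integral_congr_ae ?_
    have : ∀ᵐ s : ℝ, s ≠ r := compl_mem_ae_iff.2 (measure_singleton r)
    filter_upwards [this] with s hs hs'
    rw [Set.uIoc_of_le hr] at hs'
    rw [Set.indicator_of_mem (show s ∈ Set.Iio r from hs'.2.lt_of_ne hs), one_mul]
  · rw [h1, integrable_indicator_iff hball]
    exact integrableOn_gaugeBall hα hf r

lemma continuous_partialDeriv_partialDeriv {u : Space m n → ℝ} (hu : ContDiff ℝ 2 u)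
    (k : Fin m ⊕ Fin n) : Continuous (partialDeriv k (partialDeriv k u)) :=
  continuous_partialDeriv (contDiff_partialDeriv hu k) k

/-- A radial cutoff `φ(ρ)` which is constant near `ρ = 0` is differentiable. -/
lemma hasLineDerivAt_comp_gauge (hα : 0 ≤ α) {φ η : ℝ → ℝ} (hφ : ∀ s, HasDerivAt φ (η s) s)
    {ε : ℝ} (hε : 0 < ε) (hη : ∀ s < ε, η s = 0) (z v : Space m n) :
    HasLineDerivAt ℝ (fun z => φ (gauge α z)) (η (gauge α z) * fderiv ℝ (gauge α) z v) z v := by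
  by_cases hz : z = 0
  · have h0 : gauge α z = 0 := (gauge_eq_zero_iff hα).2 hz
    have hconst : (fun z => φ (gauge α z)) =ᶠ[𝓝 z] fun _ => φ 0 := by
      filter_upwards [(continuous_gauge hα).continuousAt.eventually
        (gt_mem_nhds (h0 ▸ hε : gauge α z < ε))] with w hw
      have hw' : gauge α w < ε := hw
      refine (constant_of_has_deriv_right_zero (a := 0) (b := gauge α w)
        (fun s _ => (hφ s).continuousAt.continuousWithinAt) (fun s hs => ?_) _
        (Set.right_mem_Icc.2 (gauge_nonneg α w)))
      have := hφ s
      rw [hη s (hs.2.trans hw')] at this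
      exact this.hasDerivWithinAt
    have h1 : HasFDerivAt (fun z => φ (gauge α z)) (0 : Space m n →L[ℝ] ℝ) z :=
      (hasFDerivAt_const (φ 0) z).congr_of_eventuallyEq hconst
    have h2 := h1.hasLineDerivAt v
    rwa [h0, hη 0 hε, zero_mul]
  · have h1 := (contDiffAt_gauge hα hz).differentiableAt one_ne_zero
    have h2 := ((hφ (gauge α z)).comp_hasFDerivAt z h1.hasFDerivAt).hasLineDerivAt v
    simpa [Function.comp_def] using h2

/-- The `k`-th coefficient is constant along the `k`-th coordinate lines; this is why integration
by parts in the direction `k` needs no differentiability of the coefficients. -/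
lemma coeff_add_smul_single (k : Fin m ⊕ Fin n) (z : Space m n) (t : ℝ) :
    coeff α k (z + t • EuclideanSpace.single k (1 : ℝ)) = coeff α k z := by
  rcases k with i | j
  · rfl
  · have : xPart (z + t • EuclideanSpace.single (Sum.inr j) (1 : ℝ)) = xPart z := by
      ext i; simp
    simp only [coeff, Sum.elim_inr, this]

lemma continuous_mul_rpow_of_vanishing {η : ℝ → ℝ} (q : ℝ) (hηc : Continuous η) {ε : ℝ}
    (hε : 0 < ε) (hη : ∀ s < ε, η s = 0) : Continuous fun s : ℝ => η s * s ^ q := by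
  refine continuous_iff_continuousAt.2 fun s => ?_
  by_cases hs : s = 0
  · refine continuousAt_const.congr (f := fun _ => (0 : ℝ)) ?_
    filter_upwards [gt_mem_nhds (hs ▸ hε : s < ε)] with t ht
    rw [hη t ht, zero_mul]
  · exact hηc.continuousAt.mul (Real.continuousAt_rpow_const _ _ (Or.inl hs))

/-- Green's formula tested against a radial cutoff: the boundary term only involves the generator
of the dilations. -/
lemma integral_cutoff_mul_green (hα : 0 ≤ α) {u w : Space m n → ℝ} (hu : ContDiff ℝ 2 u)
    (hw : ContDiff ℝ 1 w) {φ η : ℝ → ℝ} (hφ : ∀ s, HasDerivAt φ (η s) s) (hηc : Continuous η)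
    {ε R : ℝ} (hε : 0 < ε) (hη : ∀ s < ε, η s = 0) (hφR : ∀ s, R ≤ s → φ s = 0)
    (hηR : ∀ s, R ≤ s → η s = 0) :
    ∫ z, φ (gauge α z) * (∑ k, coeff α k z * partialDeriv k u z * partialDeriv k w z
        + w z * grushinLaplacian α u z)
      = -∫ z, η (gauge α z) * gauge α z ^ (-(2 * α + 1))
          * (‖xPart z‖ ^ (2 * α) * (w z * generator α u z)) := by
  have hφc : Continuous φ := continuous_iff_continuousAt.2 fun s => (hφ s).continuousAt
  have hg := continuous_gauge (m := m) (n := n) hα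
  have hθ := continuous_mul_rpow_of_vanishing (-(2 * α + 1)) hηc hε hη
  have hx : Continuous fun z : Space m n => ‖xPart z‖ ^ (2 * α) :=
    (Real.continuous_rpow_const (by positivity)).comp continuous_xPart.norm
  have hcoeff := fun k => continuous_coeff (m := m) (n := n) hα k
  have hdu := fun k => continuous_partialDeriv (hu.of_le (by norm_num)) k
  have hddu := fun k => continuous_partialDeriv_partialDeriv hu k
  have hdw := fun k => continuous_partialDeriv hw k
  have hEul : ∀ k, Continuous fun z : Space m n => eulerField α z k := fun k =>
    (EuclideanSpace.proj k).continuous.comp continuous_eulerField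
  have hint : ∀ {f g : Space m n → ℝ}, Continuous g → (∀ s, R ≤ s → ∀ z, gauge α z = s → f z = 0) →
      Continuous f → Integrable fun z => f z * g z := fun {f g} hgc h0 hfc =>
    (hfc.mul hgc).integrable_of_hasCompactSupport
      (HasCompactSupport.intro (isCompact_gauge_le hα R) fun z hz => by
        rw [Pi.mul_apply, h0 _ (le_of_lt (not_le.1 hz)) z rfl, zero_mul])
  -- the derivative of `coeff k * φ(ρ) * w` in the direction `k`
  let d : Fin m ⊕ Fin n → Space m n → ℝ := fun k z =>
    φ (gauge α z) * (coeff α k z * partialDeriv k w z)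
      + η (gauge α z) * gauge α z ^ (-(2 * α + 1)) * (‖xPart z‖ ^ (2 * α) * eulerField α z k * w z)
  have hparts : ∀ k, ∫ z, φ (gauge α z) * (coeff α k z * w z)
      * partialDeriv k (partialDeriv k u) z = -∫ z, d k z * partialDeriv k u z := fun k => by
    refine integral_bilinear_hasLineDerivAt_right_eq_neg_left_of_integrable
      (B := ContinuousLinearMap.mul ℝ ℝ) (v := EuclideanSpace.single k (1 : ℝ))
      (f := fun z => φ (gauge α z) * (coeff α k z * w z)) ?_ ?_ ?_ ?_ ?_
    · refine hint (hdu k) (fun s hs z hz => ?_) ?_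
      · simp only [d]
        rw [hz, hφR s hs, hηR s hs]; ring
      · exact ((hφc.comp hg).mul ((hcoeff k).mul (hdw k))).add
          ((hθ.comp hg).mul ((hx.mul (hEul k)).mul hw.continuous))
    · refine hint (hddu k) (fun s hs z hz => ?_) ?_
      · rw [hz, hφR s hs, zero_mul]
      · exact (hφc.comp hg).mul ((hcoeff k).mul hw.continuous)
    · refine hint (hdu k) (fun s hs z hz => ?_) ?_
      · rw [hz, hφR s hs, zero_mul]
      · exact (hφc.comp hg).mul ((hcoeff k).mul hw.continuous)
    · intro z _
      have h1 := hasLineDerivAt_comp_gauge hα hφ hε hη z (EuclideanSpace.single k (1 : ℝ))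
      have h2 := ((hw.differentiable one_ne_zero z).hasFDerivAt).hasLineDerivAt
        (EuclideanSpace.single k (1 : ℝ))
      have h3 := HasDerivAt.mul h1 (HasDerivAt.const_mul (coeff α k z) h2)
      have h4 : d k z = η (gauge α z) * fderiv ℝ (gauge α) z (EuclideanSpace.single k 1)
            * (coeff α k z * w z)
          + φ (gauge α z) * (coeff α k z * fderiv ℝ w z (EuclideanSpace.single k 1)) := by
        -- at `z = 0` the derivative of the gauge is a junk value, but `η` vanishes there
        by_cases hz : z = 0
        · have h0 : gauge α z = 0 := (gauge_eq_zero_iff hα).2 hz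
          simp only [d, h0, hη 0 hε, partialDeriv]; ring
        · have h5 := coeff_mul_partialDeriv_gauge hα hz k
          calc d k z = φ (gauge α z) * (coeff α k z * partialDeriv k w z)
              + η (gauge α z) * (gauge α z ^ (-(2 * α + 1)) * ‖xPart z‖ ^ (2 * α)
                * eulerField α z k) * w z := by simp only [d]; ring
            _ = _ := by rw [← h5]; simp only [partialDeriv]; ring
      rw [h4]
      refine (h3.congr_deriv ?_).congr_of_eventuallyEq (Eventually.of_forall fun t => ?_)
      · simp
      · simp only [coeff_add_smul_single, Pi.mul_apply]
    · intro z _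
      exact (((contDiff_partialDeriv hu k).differentiable one_ne_zero z).hasFDerivAt).hasLineDerivAt
        (EuclideanSpace.single k (1 : ℝ))
  have hi1 : ∀ k, Integrable fun z => φ (gauge α z) *
      (coeff α k z * partialDeriv k u z * partialDeriv k w z) := fun k =>
    hint (((hcoeff k).mul (hdu k)).mul (hdw k)) (fun s hs z hz => by rw [hz, hφR s hs])
      (hφc.comp hg)
  have hi2 : ∀ k, Integrable fun z => φ (gauge α z) * (coeff α k z * w z)
      * partialDeriv k (partialDeriv k u) z := fun k => by
    refine hint (hddu k) (fun s hs z hz => ?_) ?_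
    · rw [hz, hφR s hs, zero_mul]
    · exact (hφc.comp hg).mul ((hcoeff k).mul hw.continuous)
  have hi3 : ∀ k, Integrable fun z => η (gauge α z) * gauge α z ^ (-(2 * α + 1)) *
      (‖xPart z‖ ^ (2 * α) * (w z * (eulerField α z k * partialDeriv k u z))) := fun k =>
    hint (hx.mul (hw.continuous.mul ((hEul k).mul (hdu k))))
      (fun s hs z hz => by rw [hz, hηR s hs, zero_mul]) (hθ.comp hg)
  have hsplit : ∀ k, ∫ z, d k z * partialDeriv k u z
      = (∫ z, φ (gauge α z) * (coeff α k z * partialDeriv k u z * partialDeriv k w z))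
        + ∫ z, η (gauge α z) * gauge α z ^ (-(2 * α + 1)) *
          (‖xPart z‖ ^ (2 * α) * (w z * (eulerField α z k * partialDeriv k u z))) := fun k => by
    rw [← integral_add (hi1 k) (hi3 k)]
    congr 1; ext z; simp only [d]; ring
  have hgen : ∀ z, generator α u z = ∑ k, eulerField α z k * partialDeriv k u z := fun z => by
    rw [generator_eq_fderiv, fderiv_apply_eq_sum, Fintype.sum_sum_type]
  have hL : (fun z => φ (gauge α z) * (∑ k, coeff α k z * partialDeriv k u z * partialDeriv k w z
        + w z * grushinLaplacian α u z))
      = fun z => ∑ k, (φ (gauge α z) * (coeff α k z * partialDeriv k u z * partialDeriv k w z)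
        + φ (gauge α z) * (coeff α k z * w z) * partialDeriv k (partialDeriv k u) z) := by
    ext z
    rw [grushinLaplacian_eq_sum, Finset.sum_add_distrib, mul_add, Finset.mul_sum, Finset.mul_sum,
      Finset.mul_sum]
    congr 1
    exact Finset.sum_congr rfl fun k _ => by ring
  have hR' : (fun z => η (gauge α z) * gauge α z ^ (-(2 * α + 1))
          * (‖xPart z‖ ^ (2 * α) * (w z * generator α u z)))
      = fun z => ∑ k, η (gauge α z) * gauge α z ^ (-(2 * α + 1)) *
          (‖xPart z‖ ^ (2 * α) * (w z * (eulerField α z k * partialDeriv k u z))) := by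
    ext z
    rw [hgen, Finset.mul_sum, Finset.mul_sum, Finset.mul_sum]
  have hi12 : ∀ k, Integrable fun z =>
      φ (gauge α z) * (coeff α k z * partialDeriv k u z * partialDeriv k w z)
        + φ (gauge α z) * (coeff α k z * w z) * partialDeriv k (partialDeriv k u) z := fun k =>
    (hi1 k).add (hi2 k)
  rw [hL, hR', integral_finsetSum _ fun k _ => hi12 k,
    integral_finsetSum _ fun k _ => hi3 k, ← Finset.sum_neg_distrib]
  refine Finset.sum_congr rfl fun k _ => ?_
  rw [integral_add (hi1 k) (hi2 k), hparts, hsplit]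
  ring

lemma continuous_grushinLaplacian (hα : 0 ≤ α) {u : Space m n → ℝ} (hu : ContDiff ℝ 2 u) :
    Continuous (grushinLaplacian α u) := by
  rw [funext fun z => grushinLaplacian_eq_sum (α := α) u z]
  exact continuous_finsetSum _ fun k _ => (continuous_coeff hα k).mul
    (continuous_partialDeriv_partialDeriv hu k)

/-- Green's formula on the gauge ball `B_r`. Both sides are continuous in `r`, so it is enough to
compare them as distributions in `r`, which is what radial cutoffs do. -/
theorem green_gaugeBall (hm : 1 ≤ m) (hn : 1 ≤ n) (hα : 0 ≤ α) {u w : Space m n → ℝ}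
    (hu : ContDiff ℝ 2 u) (hw : ContDiff ℝ 1 w) {r : ℝ} (hr : 0 < r) :
    ∫ z in gaugeBall m n α r, (∑ k, coeff α k z * partialDeriv k u z * partialDeriv k w z
        + w z * grushinLaplacian α u z)
      = r ^ (homDim m n α - 2 * α - 2)
        * sphereIntegral α (fun z => ‖xPart z‖ ^ (2 * α) * (w z * generator α u z)) r := by
  set Q := homDim m n α
  have hQ : 2 ≤ Q := two_le_homDim hm hn hα
  set f : Space m n → ℝ := fun z => ∑ k, coeff α k z * partialDeriv k u z * partialDeriv k w z
        + w z * grushinLaplacian α u z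
  set h : Space m n → ℝ := fun z => ‖xPart z‖ ^ (2 * α) * (w z * generator α u z)
  have hfc : Continuous f :=
    (continuous_finsetSum _ fun k _ => ((continuous_coeff hα k).mul
      (continuous_partialDeriv (hu.of_le (by norm_num)) k)).mul (continuous_partialDeriv hw k)).add
      (hw.continuous.mul (continuous_grushinLaplacian hα hu))
  have hhc : Continuous h :=
    ((Real.continuous_rpow_const (by positivity)).comp continuous_xPart.norm).mul
      (hw.continuous.mul (continuous_generator (hu.of_le (by norm_num))))
  set g : ℝ → ℝ := fun s => s ^ (Q - 1) * sphereIntegral α f s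
  have hgc : Continuous g := (Real.continuous_rpow_const (by linarith)).mul
    (continuous_sphereIntegral hm hα hfc)
  set N : ℝ → ℝ := fun s => s ^ (Q - 2 * α - 2) * sphereIntegral α h s
  have hNc : ContinuousOn N (Set.Ioi 0) :=
    (continuousOn_id.rpow_const fun s hs => Or.inl (ne_of_gt hs)).mul
      (continuous_sphereIntegral hm hα hhc).continuousOn
  set J : ℝ → ℝ := fun t => ∫ s in (0 : ℝ)..t, g s
  have hJ : ∀ s, HasDerivAt J (g s) s := fun s => (hgc.integral_hasStrictDerivAt 0 s).hasDerivAt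
  have hJc : Continuous J := continuous_iff_continuousAt.2 fun s => (hJ s).continuousAt
  rw [setIntegral_gaugeBall hm hα hfc hr.le]
  change J r = N r
  have hloc : LocallyIntegrableOn (fun s => J s - N s) (Set.Ioi 0) :=
    (hJc.continuousOn.sub hNc).locallyIntegrableOn measurableSet_Ioi
  have hae := isOpen_Ioi.ae_eq_zero_of_integral_contDiff_smul_eq_zero hloc ?_
  · refine Measure.eqOn_open_of_ae_eq (μ := volume) (U := Set.Ioi 0)
      ((ae_restrict_iff' measurableSet_Ioi).2 ?_) isOpen_Ioi hJc.continuousOn hNc hr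
    filter_upwards [hae] with s hs hs0
    exact sub_eq_zero.1 (hs hs0)
  intro η hη hηs hηU
  -- the support of `η` lies in some `[ε, R)`
  obtain ⟨ε, hε, hηε⟩ : ∃ ε > 0, ∀ s < ε, η s = 0 := by
    have h0 : (tsupport η)ᶜ ∈ 𝓝 (0 : ℝ) :=
      (isClosed_tsupport η).isOpen_compl.mem_nhds fun h => lt_irrefl (0 : ℝ) (hηU h)
    obtain ⟨ε, hε, hball⟩ := Metric.mem_nhds_iff.1 h0
    refine ⟨ε, hε, fun s hs => ?_⟩
    by_contra hne
    have h1 : s ∈ tsupport η := subset_tsupport η hne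
    have h2 : 0 < s := hηU h1
    exact hball (by rw [Metric.mem_ball, Real.dist_eq, sub_zero, abs_of_pos h2]; exact hs) h1
  obtain ⟨R, hR, hηR⟩ : ∃ R > 0, ∀ s, R ≤ s → η s = 0 := by
    obtain ⟨R, hRs⟩ := hηs.isCompact.isBounded.subset_closedBall 0
    refine ⟨max R 0 + 1, by positivity, fun s hs => ?_⟩
    by_contra hne
    have h1 := hRs (subset_tsupport η hne)
    rw [Metric.mem_closedBall, Real.dist_eq, sub_zero] at h1
    linarith [le_abs_self s, le_max_left R 0]
  have hηc : Continuous η := hη.continuous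
  -- the primitive of `η` vanishing near infinity
  set φ : ℝ → ℝ := fun t => ∫ s in R..t, η s
  have hφ : ∀ s, HasDerivAt φ (η s) s := fun s => (hηc.integral_hasStrictDerivAt R s).hasDerivAt
  have hφR : ∀ s, R ≤ s → φ s = 0 := fun s hs => by
    refine (intervalIntegral.integral_congr (g := fun _ => (0 : ℝ)) fun t ht => ?_).trans (by simp)
    rw [Set.uIcc_of_le hs] at ht
    exact hηR t ht.1
  have hφc : Continuous φ := continuous_iff_continuousAt.2 fun s => (hφ s).continuousAt
  have hgauge := continuous_gauge (m := m) (n := n) hα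
  have hθ := continuous_mul_rpow_of_vanishing (-(2 * α + 1)) hηc hε hηε
  have hint : ∀ {ψ : ℝ → ℝ} {k : Space m n → ℝ}, Continuous ψ → Continuous k →
      (∀ s, R ≤ s → ψ s = 0) → Integrable fun z => ψ (gauge α z) * k z := fun {ψ k} hψ hk h0 =>
    ((hψ.comp hgauge).mul hk).integrable_of_hasCompactSupport
      (HasCompactSupport.intro (isCompact_gauge_le hα R) fun z hz => by
        rw [Pi.mul_apply, Function.comp_apply, h0 _ (le_of_lt (not_le.1 hz)), zero_mul])
  have hθR : ∀ s, R ≤ s → η s * s ^ (-(2 * α + 1)) = 0 := fun s hs => by rw [hηR s hs, zero_mul]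
  have key := integral_cutoff_mul_green hα hu hw hφ hηc hε hηε hφR hηR
  rw [integral_radial_mul hm hα hfc hφc.measurable (hint hφc hfc hφR) hR.le hφR,
    integral_radial_mul hm hα hhc (φ := fun s => η s * s ^ (-(2 * α + 1))) hθ.measurable
      (hint hθ hhc hθR) hR.le hθR] at key
  have hparts := intervalIntegral.integral_mul_deriv_eq_deriv_mul (a := 0) (b := R)
    (fun s _ => hφ s) (fun s _ => hJ s) (hηc.intervalIntegrable _ _) (hgc.intervalIntegrable _ _)
  rw [hφR R le_rfl, show J 0 = 0 from intervalIntegral.integral_same, zero_mul, mul_zero, sub_zero,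
    zero_sub] at hparts
  have hcut : ∀ s ∉ Set.Ioc 0 R, η s = 0 := fun s hs => by
    rcases le_or_gt s 0 with h0 | h0
    · exact hηε s (h0.trans_lt hε)
    · exact hηR s (le_of_lt (not_le.1 fun h => hs ⟨h0, h⟩))
  have e1 : ∫ s, η s • (J s - N s) = ∫ s in (0 : ℝ)..R, (η s * J s - η s * N s) := by
    rw [intervalIntegral.integral_of_le hR.le, ← setIntegral_eq_integral_of_forall_compl_eq_zero
      (s := Set.Ioc 0 R) fun s hs => by rw [hcut s hs, zero_smul]]
    simp only [smul_eq_mul, mul_sub]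
  have e2 : Set.EqOn (fun s => η s * N s)
      (fun s => η s * s ^ (-(2 * α + 1)) * (s ^ (Q - 1) * sphereIntegral α h s))
      (Set.uIcc 0 R) := fun s hs => by
    rcases le_or_gt s 0 with h0 | h0
    · simp [hηε s (h0.trans_lt hε)]
    · simp only [N]
      rw [show Q - 2 * α - 2 = -(2 * α + 1) + (Q - 1) by ring, Real.rpow_add h0]
      ring
  have hcont2 : Continuous fun s =>
      η s * s ^ (-(2 * α + 1)) * (s ^ (Q - 1) * sphereIntegral α h s) :=
    hθ.mul ((Real.continuous_rpow_const (by linarith)).mul (continuous_sphereIntegral hm hα hhc))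
  have hi2 : IntervalIntegrable (fun s => η s * N s) volume 0 R :=
    (hcont2.intervalIntegrable _ _).congr fun s hs => (e2 (Set.uIoc_subset_uIcc hs)).symm
  have hi1 : IntervalIntegrable (fun s => η s * J s) volume 0 R :=
    (hηc.mul hJc).intervalIntegrable _ _
  rw [e1, intervalIntegral.integral_sub hi1 hi2,
    intervalIntegral.integral_congr e2]
  linarith

/-! ### The boundary term and the monotonicity formula -/

lemma generator_rescale (hu : ContDiff ℝ 2 u) (r : ℝ) (z : Space m n) :
    generator α (rescale α p r u) z
      = r ^ (2 / (p - 1)) * generator α u (dilation α r z) := by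
  let L : Space m n →L[ℝ] Space m n := LinearMap.toContinuousLinearMap (dilationLinear α r)
  have h1 : HasFDerivAt u (fderiv ℝ u (dilation α r z)) (L z) :=
    (hu.differentiable two_ne_zero _).hasFDerivAt
  have h2 : HasFDerivAt (rescale α p r u) _ z :=
    (h1.comp z L.hasFDerivAt).const_mul (r ^ (2 / (p - 1)))
  have h3 : L (eulerField α z) = eulerField α (dilation α r z) := by
    ext (i | j) <;> simp [L, dilationLinear, eulerField, mul_left_comm]
  rw [generator_eq_fderiv, generator_eq_fderiv, h2.fderiv]
  simp [h3]

lemma continuous_weight_mul (hα : 0 ≤ α) {f : Space m n → ℝ} (hf : Continuous f) (r : ℝ) :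
    Continuous fun z : Space m n => ‖xPart z‖ ^ (2 * α) * f (dilation α r z) :=
  ((Real.continuous_rpow_const (by positivity)).comp continuous_xPart.norm).mul
    (hf.comp (continuous_dilation_right α r))

/-- On the sphere `|∇ρ|` cancels against the coarea factor. -/
lemma boundaryDensity_mul (hα : 0 ≤ α) (r : ℝ) (ω : Space m n) :
    boundaryDensity α p r u ω * ‖gradient (gauge α) ω‖
      = ‖xPart ω‖ ^ (2 * α) * ((r ^ (2 / (p - 1)) * u (dilation α r ω)) ^ 2 / (p - 1))
        ∨ ω ∉ gaugeSphere m n α 1 := by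
  by_cases hω : ω ∈ gaugeSphere m n α 1
  · refine Or.inl ?_
    have := (norm_gradient_gauge_pos hα hω).ne'
    rw [boundaryDensity, rescale]
    field_simp
  · exact Or.inr hω

lemma dissipationDensity_mul (hα : 0 ≤ α) (hu : ContDiff ℝ 2 u) (r : ℝ) (ω : Space m n) :
    dissipationDensity α p r u ω * ‖gradient (gauge α) ω‖
      = ‖xPart ω‖ ^ (2 * α) * ((r ^ (2 / (p - 1)) * scalingDeriv α p u (dilation α r ω)) ^ 2 / r)
        ∨ ω ∉ gaugeSphere m n α 1 := by
  by_cases hω : ω ∈ gaugeSphere m n α 1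
  · refine Or.inl ?_
    have := (norm_gradient_gauge_pos hα hω).ne'
    rw [dissipationDensity, generator_rescale hu, rescale, scalingDeriv]
    field_simp
  · exact Or.inr hω

lemma integrable_boundaryDensity (hm : 1 ≤ m) (hα : 0 ≤ α) (hu : Continuous u) (r : ℝ) :
    Integrable (boundaryDensity α p r u) (surfaceMeasure m n α) :=
  integrable_surfaceMeasure hm hα
    (continuous_weight_mul hα (((continuous_const.mul hu).pow 2).div_const _) r)
    (boundaryDensity_mul hα r)

lemma integrable_dissipationDensity (hm : 1 ≤ m) (hα : 0 ≤ α) (hu : ContDiff ℝ 2 u) (r : ℝ) :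
    Integrable (dissipationDensity α p r u) (surfaceMeasure m n α) :=
  integrable_surfaceMeasure hm hα (continuous_weight_mul hα
    (((continuous_const.mul
      (contDiff_scalingDeriv (α := α) (p := p) hu).continuous).pow 2).div_const _) r)
    (dissipationDensity_mul hα hu r)

/-- The derivative of the boundary term, as an integral against the cone measure. -/
lemma hasDerivAt_boundary (hm : 1 ≤ m) (hα : 0 ≤ α) (hu : ContDiff ℝ 2 u) {r : ℝ} (hr : 0 < r) :
    HasDerivAt (fun s => ∫ z, boundaryDensity α p s u z ∂surfaceMeasure m n α)
      (r ^ (2 * (2 / (p - 1)) - 1) * ∫ ω, ‖xPart ω‖ ^ (2 * α) *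
        (2 / (p - 1) * u (dilation α r ω) * scalingDeriv α p u (dilation α r ω))
          ∂coneMeasure m n α) r := by
  have := isFiniteMeasure_coneMeasure (m := m) (n := n) hα
  have hw := (contDiff_scalingDeriv (α := α) (p := p) hu).continuous
  set a := 2 / (p - 1) with ha
  have hF : ∀ s, Continuous fun z : Space m n =>
      ‖xPart z‖ ^ (2 * α) * ((s ^ a * u (dilation α s z)) ^ 2 / (p - 1)) := fun s =>
    continuous_weight_mul hα (((continuous_const.mul hu.continuous).pow 2).div_const _) s
  have hd : ∀ s, 0 < s → ∀ z : Space m n, HasDerivAt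
      (fun t => ‖xPart z‖ ^ (2 * α) * ((t ^ a * u (dilation α t z)) ^ 2 / (p - 1)))
      (s ^ (2 * a - 1) * (‖xPart z‖ ^ (2 * α) *
        (a * u (dilation α s z) * scalingDeriv α p u (dilation α s z)))) s := fun s hs z => by
    have h1 := (Real.hasDerivAt_rpow_const (p := a) (Or.inl hs.ne')).mul
      (hasDerivAt_comp_dilation (α := α) (hu.differentiable two_ne_zero) hs z)
    refine (((h1.pow 2).div_const (p - 1)).const_mul (‖xPart z‖ ^ (2 * α))).congr_deriv ?_
    have e1 : s ^ a = s * s ^ (a - 1) := by rw [Real.rpow_sub hs, Real.rpow_one]; field_simp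
    have e2 : s ^ (2 * a - 1) = s * s ^ (a - 1) * s ^ (a - 1) := by
      rw [← e1, ← Real.rpow_add hs]; congr 1; ring
    simp only [Pi.mul_apply, scalingDeriv, ← ha, e1, e2]
    push_cast
    rw [ha]
    field_simp
  have h := hasDerivAt_integral_of_compact (isCompact_gaugeSphere (m := m) (n := n) hα 1)
    (ae_coneMeasure_mem hm hα) hr (fun s _ => hF s) ?_ hd (integrable_coneMeasure hm hα (hF r))
  · rw [integral_const_mul] at h
    refine h.congr_of_eventuallyEq (Eventually.of_forall fun s => ?_)
    exact integral_surfaceMeasure hm hα _ _ (boundaryDensity_mul hα s)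
  · have hδ := continuous_dilation (m := m) (n := n) hα
    refine ContinuousOn.mul (ContinuousOn.rpow_const continuousOn_fst fun q hq => Or.inl ?_)
      (Continuous.continuousOn ?_)
    · exact (show 0 < q.1 from hq.1).ne'
    · exact ((Real.continuous_rpow_const (by positivity)).comp
        (continuous_xPart.comp continuous_snd).norm).mul
        ((continuous_const.mul (hu.continuous.comp hδ)).mul (hw.comp hδ))

/-- The derivative of the energy of a solution, as an integral over the gauge sphere. -/
lemma hasDerivAt_energy_of_solution (hm : 1 ≤ m) (hn : 1 ≤ n) (hα : 0 ≤ α) (hp : 1 < p)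
    (hu : IsC2Solution α p u) {r : ℝ} (hr : 0 < r) :
    HasDerivAt (fun s => energy α p s u)
      (r ^ (2 * (2 / (p - 1)) - 1) * ∫ ω, ‖xPart ω‖ ^ (2 * α) *
        (scalingDeriv α p u (dilation α r ω) * generator α u (dilation α r ω))
          ∂coneMeasure m n α) r := by
  have hw := contDiff_scalingDeriv (α := α) (p := p) hu.1
  refine (hasDerivAt_energy hα hp hu.1 hr).congr_deriv ?_
  have h1 : firstVariation α p u (scalingDeriv α p u) = fun z =>
      ∑ k, coeff α k z * partialDeriv k u z * partialDeriv k (scalingDeriv α p u) z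
        + scalingDeriv α p u z * grushinLaplacian α u z := by
    ext z
    rw [firstVariation, ← hu.2 z]
    ring
  have h2 : sphereIntegral α (fun z : Space m n => ‖xPart z‖ ^ (2 * α)
      * (scalingDeriv α p u z * generator α u z)) r
      = r ^ (2 * α) * ∫ ω, ‖xPart ω‖ ^ (2 * α) *
        (scalingDeriv α p u (dilation α r ω) * generator α u (dilation α r ω))
          ∂coneMeasure m n α := by
    rw [sphereIntegral, ← integral_const_mul]
    congr 1
    ext ω
    rw [norm_xPart_dilation α hr.le, Real.mul_rpow hr.le (norm_nonneg _), mul_assoc]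
  rw [h1, green_gaugeBall hm hn hα hu.1 hw hr, h2, ← mul_assoc, ← mul_assoc, ← Real.rpow_add hr,
    ← Real.rpow_add hr]
  congr 2
  have : p - 1 ≠ 0 := by linarith
  field_simp
  ring

lemma hasDerivAt_monotoneEnergy (hm : 1 ≤ m) (hn : 1 ≤ n) (hα : 0 ≤ α) (hp : 1 < p)
    (hu : IsC2Solution α p u) {r : ℝ} (hr : 0 < r) :
    HasDerivAt (fun s => monotoneEnergy α p s u)
      (∫ z, dissipationDensity α p r u z ∂surfaceMeasure m n α) r := by
  have hw := (contDiff_scalingDeriv (α := α) (p := p) hu.1).continuous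
  have hZ := continuous_generator (α := α) (hu.1.of_le (m := 1) (by norm_num))
  have hi1 : Integrable (fun ω => ‖xPart ω‖ ^ (2 * α) *
      (scalingDeriv α p u (dilation α r ω) * generator α u (dilation α r ω)))
      (coneMeasure m n α) :=
    integrable_coneMeasure hm hα (continuous_weight_mul hα (hw.mul hZ) r)
  have hi2 : Integrable (fun ω => ‖xPart ω‖ ^ (2 * α) *
      (2 / (p - 1) * u (dilation α r ω) * scalingDeriv α p u (dilation α r ω)))
      (coneMeasure m n α) :=
    integrable_coneMeasure hm hα (continuous_weight_mul hα
      ((continuous_const.mul hu.1.continuous).mul hw) r)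
  refine ((hasDerivAt_energy_of_solution hm hn hα hp hu hr).add
    (hasDerivAt_boundary (p := p) hm hα hu.1 hr)).congr_deriv ?_
  rw [integral_surfaceMeasure hm hα _ _ (dissipationDensity_mul hα hu.1 r), ← mul_add,
    ← integral_add hi1 hi2, ← integral_const_mul]
  congr 1
  ext ω
  have e1 : r ^ (2 * (2 / (p - 1)) - 1) = (r ^ (2 / (p - 1))) ^ 2 / r := by
    rw [Real.rpow_sub hr, Real.rpow_one, mul_comm, Real.rpow_mul hr.le, Real.rpow_two]
  rw [e1]
  simp only [scalingDeriv]
  ring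

lemma integral_dissipationDensity_nonneg {r : ℝ} (hr : 0 < r) :
    0 ≤ ∫ z, dissipationDensity α p r u z ∂surfaceMeasure m n α :=
  integral_nonneg fun z => by
    simp only [Pi.zero_apply, dissipationDensity]
    positivity

end Grushin

end

theorem mainTheorem3 (m n : ℕ) (hm : 1 ≤ m) (hn : 1 ≤ n) (α p : ℝ) (hα : 0 ≤ α) (hp : 1 < p)
    (u : Grushin.Space m n → ℝ) (hu : Grushin.IsC2Solution α p u) :
    (∀ r : ℝ, 0 < r →
      IntegrableOn (fun z => ‖Grushin.grushinGradient α u z‖ ^ 2) (Grushin.gaugeBall m n α r) ∧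
      IntegrableOn (fun z => |u z| ^ (p + 1)) (Grushin.gaugeBall m n α r) ∧
      Integrable (Grushin.boundaryDensity α p r u) (Grushin.surfaceMeasure m n α) ∧
      Integrable (Grushin.dissipationDensity α p r u) (Grushin.surfaceMeasure m n α) ∧
      HasDerivAt (fun s => Grushin.monotoneEnergy α p s u)
        (∫ z, Grushin.dissipationDensity α p r u z ∂(Grushin.surfaceMeasure m n α)) r ∧
      0 ≤ ∫ z, Grushin.dissipationDensity α p r u z ∂(Grushin.surfaceMeasure m n α)) ∧
    MonotoneOn (fun r => Grushin.monotoneEnergy α p r u) (Set.Ioi 0) := by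
  have hd : ∀ r : ℝ, 0 < r → HasDerivAt (fun s => Grushin.monotoneEnergy α p s u)
      (∫ z, Grushin.dissipationDensity α p r u z ∂(Grushin.surfaceMeasure m n α)) r :=
    fun r hr => Grushin.hasDerivAt_monotoneEnergy hm hn hα hp hu hr
  refine ⟨fun r hr => ⟨Grushin.integrableOn_gradient hα hu.1 r,
    Grushin.integrableOn_power hα hp hu.1.continuous r,
    Grushin.integrable_boundaryDensity hm hα hu.1.continuous r,
    Grushin.integrable_dissipationDensity hm hα hu.1 r, hd r hr,
    Grushin.integral_dissipationDensity_nonneg hr⟩, ?_⟩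
  refine monotoneOn_of_deriv_nonneg (convex_Ioi 0)
    (fun r hr => (hd r hr).continuousAt.continuousWithinAt) ?_ ?_ <;> rw [interior_Ioi] <;>
    intro r hr
  · exact (hd r hr).differentiableAt.differentiableWithinAt
  · rw [(hd r hr).deriv]
    exact Grushin.integral_dissipationDensity_nonneg hr
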